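/- For a finite group $H$ and an integer $k\ge 1$ let $\psi_k(H)=\sum_{h\in H} o(h)^k$, where $o(h)$ is the order of $h$; let $\mathbb{Z}_n$ be the cyclic group of order $n$, and put $$D_k=\frac{1+15\cdot 2^k+20\cdot 3^k+24\cdot 5^k}{(1+2^k+2\cdot 4^k)(1+2\cdot 3^k)(1+4\cdot 5^k)}.$$ Let $G$ be a finite group of order $n$, and let $p$ be the largest prime dividing $n$. 1. If $p>7$ and there is an integer $k\ge 4$ with $\psi_k(G)>D_k\,\psi_k(\mathbb{Z}_n)$, then $G$ is solvable. 2. If $p=7$ and there is an integer $k\ge 13$ with $\psi_k(G)>D_k\,\psi_k(\mathbb{Z}_n)$, then $G$ is solvable. Moreover, $D_k=\psi_k(A_5)/\psi_k(\mathbb{Z}_{60})$ for every $k\ge 1$, where $A_5$ is the alternating group of degree $5$. -/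

import Mathlib

/-- The sum `ψ_k(G)` of the `k`-th powers of the orders of the elements of a finite group `G`.
It is only used for finite `G`, where the `finsum` is the ordinary finite sum. -/
noncomputable def psi (k : ℕ) (G : Type*) [Group G] : ℕ :=
  ∑ᶠ g : G, orderOf g ^ k

theorem psi_eq_sum (k : ℕ) (G : Type*) [Group G] [Fintype G] :
    psi k G = ∑ g : G, orderOf g ^ k :=
  finsum_eq_sum_of_fintype _

/-- The cyclic group `ℤ_n`, written multiplicatively. -/
abbrev Zmul (n : ℕ) : Type := Multiplicative (ZMod n)

/-- The constant `D_k`. -/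
noncomputable def Dconst (k : ℕ) : ℝ :=
  (1 + 15 * 2 ^ k + 20 * 3 ^ k + 24 * 5 ^ k) /
    ((1 + 2 ^ k + 2 * 4 ^ k) * (1 + 2 * 3 ^ k) * (1 + 4 * 5 ^ k))

/-!
For `k ≥ 4`, every finite nonsolvable group `G` of order `n` satisfies
`ψ_k(G) ψ_k(ℤ₆₀) ≤ ψ_k(A₅) ψ_k(ℤ_n)` (`psi_mul_cyclicPsi_sixty_le_of_not_isSolvable`); both
solvability criteria are this inequality read backwards. The proof is by induction on `n`.

Suppose the inequality fails, and let `C` be a cyclic subgroup of maximal order. Comparing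
`ψ_k(G) ≤ n |C| ^ k` with `ψ_k(ℤ_n) ≥ φ(n) n ^ k` bounds `[G : C]`, unless it is below `12`, by `12`
times the fourth root of `(2 / 3) n / φ(n)` (`exists_isCyclic_index_lt`), and `n / φ(n)` is bounded
in terms of the largest prime `p` dividing `n` (`mul_le_mul_totient`).

* If `p ≥ 17`, then `[G : C] < p`. So `C` contains a Sylow `p`-subgroup `P`, which is cyclic, and
  the number of Sylow `p`-subgroups divides `[G : C]`, so `P` is normal. As
  `ψ_k(G) ≤ ψ_k(P) ψ_k(G / P)` (`psi_le_of_sylow_normal`), the inequality for `G` follows from that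
  for `G / P`.
* If `p ≤ 16`, then `[G : C] ≤ 16`, and `G` is an extension of a subgroup of `C` by a simple group
  of order `60` (`exists_surjective_simple_of_index_le`). For such extensions, which are central,
  the inequality is checked coset by coset (`psi_mul_cyclicPsi_sixty_le`).

The structure theorem rests on the simple case (`card_of_isCyclic_of_index_le`): a nonabelian simple
group `X` with a cyclic subgroup `D` of index at most `16` has order `60`. Here `|D| < [X : D]`,
because `D` meets one of its conjugates trivially (`exists_conj_disjoint_of_isSimpleGroup`); so
`|X|` is small, and Sylow counting, Burnside's transfer theorem, and an argument on the orbits of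
`D` on Sylow subgroups (`mulAut_pow_eq_one_of_sylow`) exclude all other orders. The index of a
cyclic subgroup is multiplicative along normal series and is at least `12` on each nonabelian
composition factor, so index at most `16` forces exactly one such factor, and the subgroup covers
all the other ones.
-/

open Subgroup
open scoped Pointwise

universe u

/-! ### Sylow theory of finite nonabelian simple groups -/

section Simple

variable {X : Type*} [Group X] [Finite X] [IsSimpleGroup X]

/-- A finite nonabelian simple group acts faithfully and by even permutations on the cosets of a
proper subgroup. -/
theorem two_mul_card_dvd_factorial_index (hX : ¬ Group.IsSolvable X) {H : Subgroup X}
    (hH : H ≠ ⊤) : 2 * Nat.card X ∣ H.index.factorial := by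
  classical
  have := Fintype.ofFinite (X ⧸ H)
  set φ := MulAction.toPermHom X (X ⧸ H)
  have hker : φ.ker = ⊥ := by
    rw [← Subgroup.normalCore_eq_ker]
    refine (Subgroup.normalCore_normal H).eq_bot_or_eq_top.resolve_right fun h => hH ?_
    exact top_le_iff.mp (h ▸ H.normalCore_le)
  have hinj : Function.Injective φ := (MonoidHom.ker_eq_bot_iff φ).mp hker
  have hsign : (Equiv.Perm.sign.comp φ).ker = ⊤ := by
    refine (MonoidHom.normal_ker _).eq_bot_or_eq_top.resolve_left fun h => hX ?_
    exact Group.isSolvable_of_isSolvable_injective ((MonoidHom.ker_eq_bot_iff _).mp h)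
  have hmem : ∀ x, φ x ∈ alternatingGroup (X ⧸ H) := fun x => by
    have : x ∈ (Equiv.Perm.sign.comp φ).ker := hsign ▸ mem_top x
    exact this
  have hdvd := Subgroup.card_dvd_of_injective (φ.codRestrict _ hmem)
    (fun a b h => hinj (congrArg Subtype.val h))
  have : Nontrivial (X ⧸ H) := by
    rw [← not_subsingleton_iff_nontrivial]
    exact fun h => hH (QuotientGroup.subgroup_eq_top_of_subsingleton H h)
  rw [Subgroup.index, ← Nat.card_perm, ← two_mul_nat_card_alternatingGroup]
  exact Nat.mul_dvd_mul_left 2 hdvd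

theorem Sylow.ne_top_of_not_isSolvable {G : Type*} [Group G] [Finite G]
    (hG : ¬ Group.IsSolvable G) {q : ℕ} [Fact q.Prime] (Q : Sylow q G) : (Q : Subgroup G) ≠ ⊤ := by
  intro h
  have := Q.isPGroup'.isNilpotent
  have : Group.IsSolvable Q := inferInstance
  apply hG
  rw [h] at this
  exact Group.isSolvable_of_surjective (f := (⊤ : Subgroup G).subtype)
    (MonoidHom.range_eq_top.mp (range_subtype ⊤))

theorem Sylow.normalizer_ne_top_of_isSimpleGroup (hX : ¬ Group.IsSolvable X) {q : ℕ}
    [Fact q.Prime] (hq : q ∣ Nat.card X) (Q : Sylow q X) : normalizer (Q : Set X) ≠ ⊤ := by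
  intro h
  have : (Q : Subgroup X).Normal := Subgroup.normalizer_eq_top_iff.mp h
  exact this.eq_bot_or_eq_top.elim (Q.ne_bot_of_dvd_card hq) (Q.ne_top_of_not_isSolvable hX)

theorem not_normalizer_le_centralizer (hX : ¬ Group.IsSolvable X) {q : ℕ}
    [Fact q.Prime] (hq : q ∣ Nat.card X) (Q : Sylow q X) :
    ¬ normalizer (Q : Set X) ≤ centralizer (Q : Set X) := by
  intro h
  have hc := MonoidHom.ker_transferSylow_isComplement' Q h
  rcases (MonoidHom.normal_ker (MonoidHom.transferSylow Q h)).eq_bot_or_eq_top with hk | hk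
  · rw [hk] at hc
    exact Q.ne_top_of_not_isSolvable hX (isComplement'_bot_left.mp hc)
  · rw [hk] at hc
    exact Q.ne_bot_of_dvd_card hq (isComplement'_top_left.mp hc)

/-- Constraints on the number of Sylow `q`-subgroups of a nonabelian simple group. The last one is
Burnside's transfer theorem: the normalizer of a Sylow subgroup cannot have order `q`. -/
theorem card_sylow_of_isSimpleGroup (hX : ¬ Group.IsSolvable X) {q : ℕ}
    [Fact q.Prime] (hq : q ∣ Nat.card X) :
    Nat.card (Sylow q X) ∣ Nat.card X ∧ Nat.card (Sylow q X) ≡ 1 [MOD q] ∧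
      2 * Nat.card X ∣ (Nat.card (Sylow q X)).factorial ∧
      Nat.card (Sylow q X) * q ≠ Nat.card X := by
  have Q : Sylow q X := default
  have hn := Q.card_eq_index_normalizer
  refine ⟨?_, card_sylow_modEq_one q X, ?_, ?_⟩
  · rw [hn]; exact Subgroup.index_dvd_card _
  · rw [hn]
    exact two_mul_card_dvd_factorial_index hX (Q.normalizer_ne_top_of_isSimpleGroup hX hq)
  · intro h
    have hcard : Nat.card (normalizer (Q : Set X)) = q := by
      have := (normalizer (Q : Set X)).index_mul_card
      rw [← hn, ← h] at this
      exact Nat.eq_of_mul_eq_mul_left Nat.card_pos this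
    have hcyc : IsCyclic (normalizer (Q : Set X)) := isCyclic_of_prime_card hcard
    refine not_normalizer_le_centralizer hX hq Q fun a ha b hb => ?_
    have := hcyc.commGroup.mul_comm ⟨b, le_normalizer hb⟩ ⟨a, ha⟩
    exact congrArg Subtype.val this

end Simple

/-- A cyclic subgroup whose index is prime to `q` contains a Sylow `q`-subgroup, which it
normalizes. -/
theorem exists_sylow_le_of_not_dvd_index {G : Type*} [Group G] [Finite G] {D : Subgroup G}
    {q : ℕ} [Fact q.Prime] (hq : ¬ q ∣ D.index) : ∃ Q : Sylow q G, (Q : Subgroup G) ≤ D := by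
  have S : Sylow q D := default
  obtain ⟨Q, hQ⟩ := (S.isPGroup'.map D.subtype).exists_le_sylow
  refine ⟨Q, ?_⟩
  have h1 : Nat.card (Subgroup.map D.subtype S) = Nat.card Q := by
    rw [Nat.card_congr (S.equivMapOfInjective D.subtype D.subtype_injective).symm.toEquiv]
    have := S.card_eq_multiplicity
    rw [Q.card_eq_multiplicity, ← D.index_mul_card,
      Nat.factorization_mul Subgroup.index_ne_zero_of_finite Nat.card_pos.ne', Finsupp.add_apply,
      Nat.factorization_eq_zero_of_not_dvd hq, zero_add]
    exact this
  rw [← Subgroup.eq_of_le_of_card_ge hQ h1.ge]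
  exact Subgroup.map_subtype_le _

theorem Subgroup.le_normalizer_of_isCyclic {G : Type*} [Group G] {D Q : Subgroup G} [IsCyclic D]
    (h : Q ≤ D) : D ≤ normalizer (Q : Set G) := by
  intro a ha
  rw [Subgroup.mem_normalizer_iff]
  have hc : ∀ b ∈ D, a * b * a⁻¹ = b := fun b hb => by
    have := congrArg Subtype.val
      ((IsCyclic.commGroup (α := D)).mul_comm ⟨a, ha⟩ ⟨b, hb⟩)
    simp only [Subgroup.coe_mul] at this
    rw [this]; group
  intro b
  constructor
  · intro hb; rwa [hc b (h hb)]
  · intro hb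
    have hbD : b ∈ D := by
      have := D.mul_mem (D.mul_mem (D.inv_mem ha) (h hb)) ha
      simpa [mul_assoc] using this
    rwa [hc b hbD] at hb

/-! ### Cyclic subgroups of simple groups -/

/-- A cyclic group has at most one subgroup of each order. -/
theorem mem_zpowers_of_pow_orderOf_eq_one {G : Type*} [Group G] [Finite G] {D : Subgroup G}
    [IsCyclic D] {x y : G} (hx : x ∈ D) (hy : y ∈ D) (h : x ^ orderOf y = 1) :
    x ∈ zpowers y := by
  classical
  have := Fintype.ofFinite D
  let y' : D := ⟨y, hy⟩
  have ho : orderOf y' = orderOf y := Subgroup.orderOf_mk y hy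
  have h1 := IsCyclic.card_pow_eq_one_le (α := D) (orderOf_pos y')
  have hsub : (Finset.univ.filter fun b : D => b ∈ zpowers y') ⊆
      Finset.univ.filter fun b : D => b ^ orderOf y' = 1 := by
    intro b hb
    simp only [Finset.mem_filter, Finset.mem_univ, true_and] at hb ⊢
    obtain ⟨i, rfl⟩ := Subgroup.mem_zpowers_iff.mp hb
    rw [← zpow_natCast, ← zpow_mul, mul_comm, zpow_mul, zpow_natCast, pow_orderOf_eq_one, one_zpow]
  have hcard : (Finset.univ.filter fun b : D => b ∈ zpowers y').card = orderOf y' := by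
    rw [← Nat.card_zpowers, ← Fintype.card_subtype, ← Nat.card_eq_fintype_card]
  have heq := Finset.eq_of_subset_of_card_le hsub (hcard ▸ h1)
  have hmem : (⟨x, hx⟩ : D) ∈ Finset.univ.filter fun b : D => b ^ orderOf y' = 1 := by
    simp only [Finset.mem_filter, Finset.mem_univ, true_and, ho]
    exact Subtype.ext h
  rw [← heq] at hmem
  simp only [Finset.mem_filter, Finset.mem_univ, true_and] at hmem
  obtain ⟨i, hi⟩ := Subgroup.mem_zpowers_iff.mp hmem
  exact Subgroup.mem_zpowers_iff.mpr ⟨i, congrArg Subtype.val hi⟩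

/-- A proper cyclic subgroup of a nonabelian simple group meets one of its conjugates trivially:
otherwise the group is the union of the normalizers of the subgroups of prime order of `D`, and by
B. H. Neumann's lemma one of these has index at most the number of primes dividing `|D|`. -/
theorem exists_conj_disjoint_of_isSimpleGroup {X : Type*} [Group X] [Finite X] [IsSimpleGroup X]
    (hX : ¬ Group.IsSolvable X) {D : Subgroup X} [IsCyclic D] (hD : D ≠ ⊤) :
    ∃ g ∉ D, ∀ a ∈ D, g * a * g⁻¹ ∈ D → a = 1 := by
  classical
  by_contra! hcon
  have hbot : D ≠ ⊥ := by
    rintro rfl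
    obtain ⟨g, -, hg⟩ := SetLike.exists_of_lt (lt_top_iff_ne_top.mpr hD)
    obtain ⟨a, ha, -, hne⟩ := hcon g hg
    exact hne (mem_bot.mp ha)
  set s := (Nat.card D).primeFactors
  have hprime : ∀ q ∈ s, ∃ x ∈ D, orderOf x = q := fun q hq => by
    have : Fact q.Prime := ⟨Nat.prime_of_mem_primeFactors hq⟩
    obtain ⟨x, hx⟩ := exists_prime_orderOf_dvd_card' (G := D) q (Nat.dvd_of_mem_primeFactors hq)
    exact ⟨x, x.2, (Subgroup.orderOf_coe x).trans hx⟩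
  choose! x hxD hxo using hprime
  -- every `g` normalizes one of the subgroups of prime order
  have hnorm : ∀ g : X, ∃ q ∈ s, g ∈ normalizer (zpowers (x q) : Set X) := by
    intro g
    obtain ⟨a, haD, hga, ha1⟩ : ∃ a ∈ D, g * a * g⁻¹ ∈ D ∧ a ≠ 1 := by
      by_cases hg : g ∈ D
      · obtain ⟨a, hne⟩ := Subgroup.ne_bot_iff_exists_ne_one.mp hbot
        refine ⟨a, a.2, D.mul_mem (D.mul_mem hg a.2) (D.inv_mem hg), ?_⟩
        exact fun h => hne (Subtype.ext h)
      · exact hcon g hg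
    obtain ⟨q, hq, hqd⟩ := Nat.exists_prime_and_dvd (n := orderOf a)
      (fun h => ha1 (orderOf_eq_one_iff.mp h))
    have hqs : q ∈ s := Nat.mem_primeFactors.mpr ⟨hq, hqd.trans
      (Subgroup.orderOf_mk a haD ▸ orderOf_dvd_natCard (⟨a, haD⟩ : D)), Nat.card_pos.ne'⟩
    have hao : orderOf (a ^ (orderOf a / q)) = q :=
      orderOf_pow_orderOf_div (orderOf_pos a).ne' hqd
    set b := a ^ (orderOf a / q)
    have hbD : b ∈ D := D.pow_mem haD _
    have hgb : g * b * g⁻¹ ∈ D := by rw [← conj_pow]; exact D.pow_mem hga _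
    have hgbo : orderOf (g * b * g⁻¹) = q := by
      rw [← hao]; exact (MulAut.conj g).orderOf_eq b
    have h1 : zpowers b = zpowers (x q) := by
      apply Subgroup.eq_of_le_of_card_ge
      · rw [zpowers_le]
        refine mem_zpowers_of_pow_orderOf_eq_one hbD (hxD q hqs) ?_
        rw [hxo q hqs, ← hao, pow_orderOf_eq_one]
      · rw [Nat.card_zpowers, Nat.card_zpowers, hao, hxo q hqs]
    have h2 : zpowers (g * b * g⁻¹) = zpowers b := by
      apply Subgroup.eq_of_le_of_card_ge
      · rw [zpowers_le]
        refine mem_zpowers_of_pow_orderOf_eq_one hgb hbD ?_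
        rw [hao, ← hgbo, pow_orderOf_eq_one]
      · rw [Nat.card_zpowers, Nat.card_zpowers, hao, hgbo]
    refine ⟨q, hqs, ?_⟩
    rw [← h1, Subgroup.mem_normalizer_iff_conj_image_eq]
    conv_rhs => rw [← h2]
    rw [← MulAut.conj_apply g b, ← MulEquiv.coe_toMonoidHom, ← MonoidHom.map_zpowers,
      Subgroup.coe_map]
  have hcover : ⋃ q ∈ s, (1 : X) • (normalizer (zpowers (x q) : Set X) : Set X) = Set.univ := by
    refine Set.eq_univ_of_forall fun g => ?_
    obtain ⟨q, hq, hg⟩ := hnorm g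
    simp only [one_smul, Set.mem_iUnion]
    exact ⟨q, hq, hg⟩
  obtain ⟨q, hq, -, hle⟩ := Subgroup.exists_index_le_card_of_leftCoset_cover hcover
  have hqp := Nat.prime_of_mem_primeFactors hq
  have hntop : normalizer (zpowers (x q) : Set X) ≠ ⊤ := by
    intro h
    have hn : (zpowers (x q)).Normal := Subgroup.normalizer_eq_top_iff.mp h
    rcases hn.eq_bot_or_eq_top with h | h
    · rw [zpowers_eq_bot, ← orderOf_eq_one_iff, hxo q hq] at h
      exact hqp.ne_one h
    · exact hD (top_le_iff.mp (h ▸ zpowers_le.mpr (hxD q hq)))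
  have hdvd := two_mul_card_dvd_factorial_index hX hntop
  set b := (normalizer (zpowers (x q) : Set X)).index
  have hsub : s ⊆ Finset.Icc 2 b := fun r hr => by
    have hr' := Nat.prime_of_mem_primeFactors hr
    refine Finset.mem_Icc.mpr ⟨hr'.two_le, (hr'.dvd_factorial).mp ?_⟩
    exact ((Nat.dvd_of_mem_primeFactors hr).trans
      (Subgroup.card_subgroup_dvd_card D)).trans ((Dvd.intro_left 2 rfl).trans hdvd)
  have hcard := Finset.card_le_card hsub
  have hb : b ≠ 0 := Subgroup.index_ne_zero_of_finite
  rw [Nat.card_Icc] at hcard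
  omega

/-- A proper cyclic subgroup of a nonabelian simple group has order less than its index. -/
theorem card_lt_index_of_isCyclic {X : Type*} [Group X] [Finite X] [IsSimpleGroup X]
    (hX : ¬ Group.IsSolvable X) (D : Subgroup X) [IsCyclic D] : Nat.card D < D.index := by
  have hD : D ≠ ⊤ := by
    rintro rfl
    have : IsCyclic X := isCyclic_of_surjective (⊤ : Subgroup X).subtype
      (MonoidHom.range_eq_top.mp (range_subtype ⊤))
    exact hX (Group.isSolvable_of_comm (IsCyclic.commGroup (α := X)).mul_comm)
  obtain ⟨g, hg, hdis⟩ := exists_conj_disjoint_of_isSimpleGroup hX hD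
  let f : D × D → X := fun p => p.1 * g * p.2
  have hinj : Function.Injective f := by
    rintro ⟨a, b⟩ ⟨a', b'⟩ h
    have h' : (a : X) * g * b = a' * g * b' := h
    have h1 : g * (b * (b' : X)⁻¹) * g⁻¹ = (a : X)⁻¹ * a' := by
      have : g * (b * (b' : X)⁻¹) * g⁻¹ = (a : X)⁻¹ * (a * g * b) * (b' : X)⁻¹ * g⁻¹ := by group
      rw [this, h']; group
    have h2 : (b : X) * (b' : X)⁻¹ = 1 := by
      refine hdis _ (D.mul_mem b.2 (D.inv_mem b'.2)) ?_
      rw [h1]; exact D.mul_mem (D.inv_mem a.2) a'.2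
    have h3 : (b : X) = b' := mul_inv_eq_one.mp h2
    rw [h2, mul_one, mul_inv_cancel] at h1
    have h4 : (a' : X) = a := (inv_mul_eq_one.mp h1.symm).symm
    exact Prod.ext (Subtype.ext h4.symm) (Subtype.ext h3)
  -- the double coset `D g D` does not contain `1`
  have hns : ¬ Function.Surjective f := by
    intro hs
    obtain ⟨⟨a, b⟩, hab⟩ := hs 1
    have hab' : (a : X) * g * b = 1 := hab
    apply hg
    have : g = (a : X)⁻¹ * (b : X)⁻¹ := by
      have : g = (a : X)⁻¹ * (a * g * b) * (b : X)⁻¹ := by group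
      rw [this, hab', mul_one]
    rw [this]
    exact D.mul_mem (D.inv_mem a.2) (D.inv_mem b.2)
  have hlt : Nat.card (D × D) < Nat.card X := by
    refine lt_of_le_of_ne (Nat.card_le_card_of_injective f hinj) fun h => hns ?_
    exact ((Nat.bijective_iff_injective_and_card f).mpr ⟨hinj, h⟩).2
  rw [Nat.card_prod, ← D.index_mul_card] at hlt
  exact lt_of_mul_lt_mul_right hlt (Nat.zero_le _)

/-- Let `α` be an automorphism having the inner automorphism by a generator `x` of a Sylow
`q`-subgroup `P` of order `q` as a power. Then `α` fixes `P`, and its orbits on the remaining Sylow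
`q`-subgroups have length divisible by `q`. -/
theorem mulAut_pow_eq_one_of_sylow {T : Type*} [Group T] [Finite T] {q : ℕ} [Fact q.Prime]
    (hfaith : ∀ t : T, (∀ Q : Sylow q T, t • Q = Q) → t = 1) {α : MulAut T} {x : T}
    (hx : orderOf x = q) {P : Sylow q T} (hP : (P : Subgroup T) = zpowers x) {w : ℕ}
    (hw : α ^ w = MulAut.conj x) {s : ℕ}
    (hs : ∀ r, 0 < r → q ∣ r → r < Nat.card (Sylow q T) → r ∣ s) : α ^ s = 1 := by
  classical
  have hqp : q.Prime := Fact.out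
  have hconj : ∀ (β : MulAut T) (t : T), MulAut.conj (β t) = β * MulAut.conj t * β⁻¹ := by
    intro β t
    ext y
    simp [MulAut.conj_apply]
  have hαx : α x = x := by
    have h1 : MulAut.conj (α x) = MulAut.conj x := by
      rw [hconj, ← hw, ← pow_succ', pow_succ, mul_inv_cancel_right]
    refine mul_inv_eq_one.mp (hfaith _ fun Q => ?_)
    rw [Sylow.smul_def, map_mul, map_inv, h1, mul_inv_cancel, one_smul]
  have hαP : α • P = P := by
    apply Sylow.ext
    change α • (P : Subgroup T) = P
    rw [hP]
    change Subgroup.map (MulEquiv.toMonoidHom α) (zpowers x) = zpowers x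
    rw [MonoidHom.map_zpowers]
    change zpowers (α x) = _
    rw [hαx]
  have hfix : ∀ Q : Sylow q T, α ^ s • Q = Q := by
    intro Q
    by_cases hQ : Q = P
    · rw [hQ]
      exact (MulAction.stabilizer (MulAut T) P).pow_mem (x := α) hαP s
    have hrpos : 0 < MulAction.period α Q :=
      MulAction.period_pos_of_orderOf_pos (orderOf_pos α) Q
    have hdvd : q ∣ MulAction.period α Q := by
      by_contra hnd
      have hcop : (orderOf x).Coprime (MulAction.period α Q) := by
        rw [hx]; exact (Nat.Prime.coprime_iff_not_dvd hqp).mpr hnd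
      have h1 : x ^ MulAction.period α Q ∈ MulAction.stabilizer T Q := by
        change x ^ MulAction.period α Q • Q = Q
        rw [Sylow.smul_def, map_pow, ← hw, ← pow_mul, mul_comm, pow_mul]
        exact (MulAction.stabilizer (MulAut T) Q).pow_mem (MulAction.pow_period_smul α Q) w
      have h2 : x ∈ MulAction.stabilizer T Q := by
        obtain ⟨m, hm⟩ := exists_pow_eq_self_of_coprime hcop.symm
        rw [← hm]
        exact Subgroup.pow_mem _ h1 m
      rw [Sylow.stabilizer_eq_normalizer, ← zpowers_le, ← hP] at h2
      have h3 := P.isPGroup'.inf_normalizer_sylow Q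
      rw [inf_eq_left.mpr h2] at h3
      have h4 : (P : Subgroup T) ≤ Q := inf_eq_left.mp h3.symm
      exact hQ (Sylow.ext (P.3 Q.2 h4))
    have hlt : MulAction.period α Q < Nat.card (Sylow q T) := by
      have := Fintype.ofFinite (Sylow q T)
      have heq : MulAction.period α Q =
          Fintype.card (MulAction.orbit (zpowers α) Q) :=
        MulAction.minimalPeriod_eq_card α Q
      rw [heq, Nat.card_eq_fintype_card]
      refine Fintype.card_lt_of_injective_of_notMem (b := P) Subtype.val Subtype.val_injective ?_
      rintro ⟨⟨_, ⟨⟨β, hβ⟩, rfl⟩⟩, h⟩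
      have h' : β • Q = P := h
      have hβP : β • P = P := by
        have : zpowers α ≤ MulAction.stabilizer (MulAut T) P := zpowers_le.mpr hαP
        exact this hβ
      exact hQ (MulAction.injective β (h'.trans hβP.symm))
    exact MulAction.pow_smul_eq_iff_period_dvd.mpr (hs _ hrpos hdvd hlt)
  ext t
  have key : t⁻¹ * (α ^ s) t = 1 := by
    refine hfaith _ fun Q => ?_
    have hinv : (α ^ s)⁻¹ • Q = Q := inv_smul_eq_iff.mpr (hfix Q).symm
    rw [Sylow.smul_def, map_mul, map_inv, hconj, mul_smul, mul_smul, mul_smul, hinv,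
      ← Sylow.smul_def, hfix, Sylow.smul_def, inv_smul_smul]
  exact (inv_mul_eq_one.mp key).symm

/-- Let `e` and `m` be the index and the order of a cyclic subgroup of a nonabelian simple group.
For each prime `q` dividing the group order `e * m`, the number `n` of Sylow `q`-subgroups satisfies
the constraints of `card_sylow_of_isSimpleGroup`; if `q` does not divide `e`, then `n` is moreover a
proper divisor of `e`. Only four pairs with `m < e ≤ 16` pass this test. -/
theorem index_card_cases : ∀ e ∈ List.range 17, ∀ m ∈ List.range e, 0 < m → 1 < e * m →
    (∀ q ∈ [2, 3, 5, 7, 11, 13], q ∣ e * m → ∃ n ∈ List.range (e * m + 1), n % q = 1 ∧ n ∣ e * m ∧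
      n * q ≠ e * m ∧ 2 * (e * m) ∣ n.factorial) →
    (∀ q ∈ [2, 3, 5, 7, 11, 13], q ∣ m → ¬ q ∣ e → ∃ n ∈ List.range e, n % q = 1 ∧ n ∣ e ∧
      2 * (e * m) ∣ n.factorial) →
    (e = 12 ∧ m = 5) ∨ (e = 12 ∧ m = 10) ∨ (e = 14 ∧ m = 12) ∨ (e = 15 ∧ m = 4) := by
  decide +kernel

theorem eq_one_of_forall_smul_sylow_eq {X : Type*} [Group X] [Finite X] [IsSimpleGroup X]
    (hX : ¬ Group.IsSolvable X) {q : ℕ} [Fact q.Prime] (hq : q ∣ Nat.card X) (t : X)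
    (ht : ∀ Q : Sylow q X, t • Q = Q) : t = 1 := by
  set φ := MulAction.toPermHom X (Sylow q X)
  have hmem : t ∈ φ.ker := by
    rw [MonoidHom.mem_ker]
    ext Q : 1
    exact ht Q
  rcases (MonoidHom.normal_ker φ).eq_bot_or_eq_top with h | h
  · rw [h] at hmem
    exact mem_bot.mp hmem
  · exfalso
    have Q : Sylow q X := default
    refine Q.normalizer_ne_top_of_isSimpleGroup hX hq (eq_top_iff.mpr fun g _ => ?_)
    rw [← Sylow.smul_eq_iff_mem_normalizer]
    have hg : g ∈ φ.ker := h ▸ mem_top g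
    exact DFunLike.congr_fun (MonoidHom.mem_ker.mp hg) Q

/-- In a nonabelian simple group, a generator `c` of a cyclic subgroup of order `q * w` that
contains a Sylow subgroup of prime order `q` has order dividing every number `s` divisible by all
multiples of `q` less than the number of Sylow `q`-subgroups. -/
theorem orderOf_dvd_of_isSimpleGroup {X : Type*} [Group X] [Finite X] [IsSimpleGroup X]
    (hX : ¬ Group.IsSolvable X) {q : ℕ} [Fact q.Prime] {c : X} {w s : ℕ}
    (hc : orderOf c = w * q) (hw : 0 < w) {Q : Sylow q X} (hQ : (Q : Subgroup X) ≤ zpowers c)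
    (hcard : Nat.card Q = q)
    (hs : ∀ r, 0 < r → q ∣ r → r < Nat.card (Sylow q X) → r ∣ s) : orderOf c ∣ s := by
  have hqX : q ∣ Nat.card X := hcard ▸ Subgroup.card_subgroup_dvd_card (Q : Subgroup X)
  have hx : orderOf (c ^ w) = q := by
    rw [orderOf_pow_of_dvd hw.ne' (hc ▸ dvd_mul_right w q), hc, Nat.mul_div_cancel_left _ hw]
  have hP : (Q : Subgroup X) = zpowers (c ^ w) := by
    apply Subgroup.eq_of_le_of_card_ge
    · intro y hy
      refine mem_zpowers_of_pow_orderOf_eq_one (D := zpowers c) (hQ hy)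
        (Subgroup.pow_mem _ (mem_zpowers c) w) ?_
      have : (⟨y, hy⟩ : Q) ^ Nat.card Q = 1 := pow_card_eq_one'
      rw [hx, ← hcard]
      exact congrArg Subtype.val this
    · rw [Nat.card_zpowers, hx]
      exact hcard.ge
  have h := mulAut_pow_eq_one_of_sylow (eq_one_of_forall_smul_sylow_eq hX hqX) hx hP
    (α := MulAut.conj c) (map_pow _ _ _).symm hs
  rw [← map_pow] at h
  refine orderOf_dvd_of_pow_eq_one (eq_one_of_forall_smul_sylow_eq hX hqX _ fun R => ?_)
  rw [Sylow.smul_def, h, one_smul]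

theorem Sylow.card_eq_of_card_eq_mul {G : Type*} [Group G] [Finite G] {q n : ℕ} [Fact q.Prime]
    (hn : Nat.card G = n * q) (hq : ¬ q ∣ n) (Q : Sylow q G) : Nat.card Q = q := by
  have hn0 : n ≠ 0 := fun h => hq (h ▸ dvd_zero q)
  have hp : q.Prime := Fact.out
  rw [Q.card_eq_multiplicity, hn, Nat.factorization_mul hn0 hp.ne_zero, Finsupp.add_apply,
    Nat.factorization_eq_zero_of_not_dvd hq, hp.factorization_self, zero_add, pow_one]

/-- A finite nonabelian simple group with a cyclic subgroup of index at most `16` has order `60`,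
and the subgroup has order `5`. -/
theorem card_of_isCyclic_of_index_le {X : Type*} [Group X] [Finite X] [IsSimpleGroup X]
    (hX : ¬ Group.IsSolvable X) (D : Subgroup X) [hD : IsCyclic D] (hD16 : D.index ≤ 16) :
    Nat.card X = 60 ∧ Nat.card D = 5 := by
  have hlt := card_lt_index_of_isCyclic hX D
  have hcard := D.index_mul_card
  have hX1 : 1 < Nat.card X := Finite.one_lt_card
  have hA : ∀ q ∈ [2, 3, 5, 7, 11, 13], q ∣ D.index * Nat.card D →
      ∃ n ∈ List.range (D.index * Nat.card D + 1), n % q = 1 ∧ n ∣ D.index * Nat.card D ∧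
      n * q ≠ D.index * Nat.card D ∧ 2 * (D.index * Nat.card D) ∣ n.factorial := by
    intro q hq hdvd
    have hqp : q.Prime := by
      simp only [List.mem_cons, List.not_mem_nil, or_false] at hq
      rcases hq with rfl | rfl | rfl | rfl | rfl | rfl <;> norm_num
    have : Fact q.Prime := ⟨hqp⟩
    rw [hcard] at hdvd ⊢
    obtain ⟨h1, h2, h3, h4⟩ := card_sylow_of_isSimpleGroup hX hdvd
    refine ⟨_, List.mem_range.mpr (Nat.lt_succ_of_le (Nat.le_of_dvd Nat.card_pos h1)), ?_, h1, h4,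
      h3⟩
    exact Eq.trans h2 (Nat.mod_eq_of_lt hqp.one_lt)
  have hsyl : ∀ q, q.Prime → q ∣ Nat.card D → ¬ q ∣ D.index → ∃ _ : Fact q.Prime,
      ∃ Q : Sylow q X, (Q : Subgroup X) ≤ D ∧ D ≤ normalizer (Q : Set X) ∧
        Nat.card (Sylow q X) ∣ D.index := by
    intro q hqp hdvd hndvd
    have : Fact q.Prime := ⟨hqp⟩
    obtain ⟨Q, hQ⟩ := exists_sylow_le_of_not_dvd_index hndvd
    have hle : D ≤ normalizer (Q : Set X) := Subgroup.le_normalizer_of_isCyclic hQ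
    exact ⟨this, Q, hQ, hle, Q.card_eq_index_normalizer ▸ Subgroup.index_dvd_of_le hle⟩
  have hB : ∀ q ∈ [2, 3, 5, 7, 11, 13], q ∣ Nat.card D → ¬ q ∣ D.index →
      ∃ n ∈ List.range D.index, n % q = 1 ∧ n ∣ D.index ∧
      2 * (D.index * Nat.card D) ∣ n.factorial := by
    intro q hq hdvd hndvd
    have hqp : q.Prime := by
      simp only [List.mem_cons, List.not_mem_nil, or_false] at hq
      rcases hq with rfl | rfl | rfl | rfl | rfl | rfl <;> norm_num
    obtain ⟨_, Q, hQ, hle, hn⟩ := hsyl q hqp hdvd hndvd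
    have hqX : q ∣ Nat.card X := hdvd.trans (Subgroup.card_subgroup_dvd_card D)
    obtain ⟨h1, h2, h3, h4⟩ := card_sylow_of_isSimpleGroup hX hqX
    refine ⟨_, List.mem_range.mpr (lt_of_le_of_ne (Nat.le_of_dvd (by omega) hn) fun h => ?_), ?_,
      hn, ?_⟩
    · -- if `D` is the whole normalizer of `Q`, Burnside's theorem applies
      have heq : D = normalizer (Q : Set X) := by
        refine Subgroup.eq_of_le_of_card_ge hle ?_
        have h5 := (normalizer (Q : Set X)).index_mul_card
        rw [← Q.card_eq_index_normalizer, h, ← hcard] at h5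
        exact (Nat.eq_of_mul_eq_mul_left (by omega) h5).le
      refine not_normalizer_le_centralizer hX hqX Q fun a ha b hb => ?_
      rw [← heq] at ha
      exact congrArg Subtype.val ((IsCyclic.commGroup (α := D)).mul_comm ⟨b, hQ hb⟩ ⟨a, ha⟩)
    · exact Eq.trans h2 (Nat.mod_eq_of_lt hqp.one_lt)
    · rw [hcard]; exact h3
  obtain ⟨c, hc⟩ := D.isCyclic_iff_exists_zpowers_eq_top.mp hD
  have hco : orderOf c = Nat.card D := by rw [← Nat.card_zpowers, hc]
  rcases index_card_cases D.index (List.mem_range.mpr (by omega)) (Nat.card D)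
    (List.mem_range.mpr hlt) Nat.card_pos (hcard ▸ hX1) hA hB with
    ⟨he, hm⟩ | ⟨he, hm⟩ | ⟨he, hm⟩ | ⟨he, hm⟩
  · rw [← hcard, he, hm]; exact ⟨rfl, rfl⟩
  · exfalso
    -- order 120: the five Sylow 5-subgroups other than `Q` form one orbit of `c`, so `c ^ 5 = 1`
    obtain ⟨_, Q, hQ, hle, hn⟩ := hsyl 5 (by norm_num) (by rw [hm]; norm_num)
      (by rw [he]; norm_num)
    have hmod := card_sylow_modEq_one 5 X
    rw [he] at hn
    have hle6 : Nat.card (Sylow 5 X) ≤ 6 := by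
      generalize Nat.card (Sylow 5 X) = n at hn hmod
      have : n ≤ 12 := Nat.le_of_dvd (by norm_num) hn
      unfold Nat.ModEq at hmod
      interval_cases n <;> omega
    have hQc := Q.card_eq_of_card_eq_mul (n := 24) (by rw [← hcard, he, hm]) (by norm_num)
    have := orderOf_dvd_of_isSimpleGroup hX (c := c) (w := 2) (s := 5) (by rw [hco, hm])
      (by norm_num) (hc ▸ hQ) hQc (fun r h0 h5 hr => by
        obtain ⟨j, rfl⟩ := h5
        have : j = 1 := by omega
        subst this; norm_num)
    rw [hco, hm] at this
    norm_num at this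
  · exfalso
    -- order 168: the orbits of `c` on the six Sylow 3-subgroups other than `Q` have length 3 or 6,
    -- so `c ^ 6 = 1`
    obtain ⟨_, Q, hQ, hle, hn⟩ := hsyl 3 (by norm_num) (by rw [hm]; norm_num)
      (by rw [he]; norm_num)
    have hmod := card_sylow_modEq_one 3 X
    rw [he] at hn
    have hle7 : Nat.card (Sylow 3 X) ≤ 7 := by
      generalize Nat.card (Sylow 3 X) = n at hn hmod
      have : n ≤ 14 := Nat.le_of_dvd (by norm_num) hn
      unfold Nat.ModEq at hmod
      interval_cases n <;> omega
    have hQc := Q.card_eq_of_card_eq_mul (n := 56) (by rw [← hcard, he, hm]) (by norm_num)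
    have := orderOf_dvd_of_isSimpleGroup hX (c := c) (w := 4) (s := 6) (by rw [hco, hm])
      (by norm_num) (hc ▸ hQ) hQc (fun r h0 h3 hr => by
        obtain ⟨j, rfl⟩ := h3
        have : j = 1 ∨ j = 2 := by omega
        rcases this with rfl | rfl <;> norm_num)
    rw [hco, hm] at this
    norm_num at this
  · exfalso
    -- order 60 with cyclic Sylow 2-subgroups: Burnside's theorem applies
    obtain ⟨_, Q, hQ, hle, hn⟩ := hsyl 2 (by norm_num) (by rw [hm]; norm_num)
      (by rw [he]; norm_num)
    have hcyc : IsCyclic Q := Subgroup.isCyclic_of_le hQ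
    have h60 : Nat.card X = 60 := by rw [← hcard, he, hm]
    exact not_normalizer_le_centralizer hX (by rw [h60]; norm_num) Q
      (IsCyclic.normalizer_le_centralizer (by rw [h60]; norm_num) hcyc)

/-! ### Simple groups of order 60 -/

/-- If the Sylow `q`-subgroups have order `q`, each element of order `q` lies in exactly one of
them. -/
theorem card_filter_orderOf_eq_prime {G : Type*} [Group G] [Fintype G] {q n : ℕ} [Fact q.Prime]
    (hn : Nat.card G = n * q) (hq : ¬ q ∣ n) :
    (Finset.univ.filter fun g : G => orderOf g = q).card = Nat.card (Sylow q G) * (q - 1) := by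
  classical
  have hp : q.Prime := Fact.out
  have := Fintype.ofFinite (Sylow q G)
  have hQ := fun Q : Sylow q G => Q.card_eq_of_card_eq_mul hn hq
  have hz : ∀ (Q : Sylow q G) (x : G), x ∈ Q → x ≠ 1 → (Q : Subgroup G) = zpowers x := by
    intro Q x hx hx1
    refine (Subgroup.eq_of_le_of_card_ge (zpowers_le.mpr hx) ?_).symm
    rw [Nat.card_zpowers]
    have h1 : orderOf x ∣ q := by
      rw [← hQ Q, ← Subgroup.orderOf_mk x hx]; exact orderOf_dvd_natCard _
    rcases (Nat.dvd_prime hp).mp h1 with h | h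
    · exact absurd (orderOf_eq_one_iff.mp h) hx1
    · rw [h]; exact (hQ Q).le
  have hunion : (Finset.univ.filter fun g : G => orderOf g = q) =
      Finset.univ.biUnion fun Q : Sylow q G => Finset.univ.filter fun g => g ∈ Q ∧ g ≠ 1 := by
    ext x
    simp only [Finset.mem_filter, Finset.mem_univ, true_and, Finset.mem_biUnion]
    constructor
    · intro hx
      have hpg : IsPGroup q (zpowers x) := IsPGroup.of_card (n := 1) (by
        rw [Nat.card_zpowers, hx, pow_one])
      obtain ⟨Q, hxQ⟩ := hpg.exists_le_sylow
      refine ⟨Q, hxQ (mem_zpowers x), ?_⟩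
      rintro rfl
      rw [orderOf_one] at hx
      exact hp.one_lt.ne hx
    · rintro ⟨Q, hxQ, hx1⟩
      rw [← Nat.card_zpowers, ← hz Q x hxQ hx1]
      exact hQ Q
  rw [hunion, Finset.card_biUnion]
  · have hc : ∀ Q : Sylow q G, (Finset.univ.filter fun g => g ∈ Q ∧ g ≠ 1).card = q - 1 := by
      intro Q
      have h1 : (Finset.univ.filter fun g => g ∈ Q ∧ g ≠ 1) =
          (Finset.univ.filter fun g => g ∈ Q).erase 1 := by
        ext x; simp [and_comm]
      rw [h1, Finset.card_erase_of_mem (by simp [one_mem]), ← Fintype.card_subtype,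
        ← Nat.card_eq_fintype_card]
      congr 1
      exact hQ Q
    rw [Finset.sum_congr rfl fun Q _ => hc Q, Finset.sum_const, smul_eq_mul, Finset.card_univ,
      Nat.card_eq_fintype_card]
  · intro Q _ R _ hQR
    rw [Function.onFun, Finset.disjoint_left]
    intro x hx hx'
    simp only [Finset.mem_filter, Finset.mem_univ, true_and] at hx hx'
    exact hQR (Sylow.ext ((hz Q x hx.1 hx.2).trans (hz R x hx'.1 hx'.2).symm))

theorem not_isSolvable_of_card_eq_sixty {X : Type*} [Group X] [IsSimpleGroup X]
    (h60 : Nat.card X = 60) : ¬ Group.IsSolvable X := by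
  intro h
  have hc := IsSimpleGroup.comm_iff_isSolvable.mpr h
  have : IsMulCommutative X := ⟨⟨hc⟩⟩
  have := Group.is_simple_iff_prime_card.mp ‹IsSimpleGroup X›
  rw [h60] at this
  norm_num at this

section Sixty

variable {X : Type*} [Group X] [Finite X] [IsSimpleGroup X]

theorem card_sylow_five_of_card_eq_sixty (h60 : Nat.card X = 60) :
    Nat.card (Sylow 5 X) = 6 := by
  have : Fact (Nat.Prime 5) := ⟨by norm_num⟩
  obtain ⟨h1, h2, h3, -⟩ := card_sylow_of_isSimpleGroup (q := 5)
    (not_isSolvable_of_card_eq_sixty h60) (by rw [h60]; norm_num)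
  rw [h60] at h1 h3
  generalize Nat.card (Sylow 5 X) = n at h1 h2 h3
  have hn : n ∈ Nat.divisors 60 := Nat.mem_divisors.mpr ⟨h1, by norm_num⟩
  rw [show Nat.divisors 60 = {1, 2, 3, 4, 5, 6, 10, 12, 15, 20, 30, 60} by decide +kernel] at hn
  simp only [Finset.mem_insert, Finset.mem_singleton] at hn
  unfold Nat.ModEq at h2
  rcases hn with rfl | rfl | rfl | rfl | rfl | rfl | rfl | rfl | rfl | rfl | rfl | rfl <;>
    first | rfl | omega | (revert h3; decide)

theorem card_sylow_three_of_card_eq_sixty (h60 : Nat.card X = 60) :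
    Nat.card (Sylow 3 X) = 10 := by
  obtain ⟨h1, h2, h3, -⟩ := card_sylow_of_isSimpleGroup (q := 3)
    (not_isSolvable_of_card_eq_sixty h60) (by rw [h60]; norm_num)
  rw [h60] at h1 h3
  generalize Nat.card (Sylow 3 X) = n at h1 h2 h3
  have hn : n ∈ Nat.divisors 60 := Nat.mem_divisors.mpr ⟨h1, by norm_num⟩
  rw [show Nat.divisors 60 = {1, 2, 3, 4, 5, 6, 10, 12, 15, 20, 30, 60} by decide +kernel] at hn
  simp only [Finset.mem_insert, Finset.mem_singleton] at hn
  unfold Nat.ModEq at h2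
  rcases hn with rfl | rfl | rfl | rfl | rfl | rfl | rfl | rfl | rfl | rfl | rfl | rfl <;>
    first | rfl | omega | (revert h3; decide)

/-- A cyclic subgroup of order at least `4` has index at most `15`, hence order `5`. -/
theorem orderOf_of_card_eq_sixty (h60 : Nat.card X = 60) (x : X) :
    orderOf x = 1 ∨ orderOf x = 2 ∨ orderOf x = 3 ∨ orderOf x = 5 := by
  have hpos := orderOf_pos x
  by_cases h : orderOf x < 4
  · omega
  · have hi := (zpowers x).index_mul_card
    rw [Nat.card_zpowers, h60] at hi
    have h5 := (card_of_isCyclic_of_index_le (not_isSolvable_of_card_eq_sixty h60) (zpowers x)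
      (by nlinarith)).2
    rw [Nat.card_zpowers] at h5
    omega

/-- A simple group of order `60` has `15`, `20` and `24` elements of order `2`, `3` and `5`. -/
theorem sum_orderOf_of_card_eq_sixty [Fintype X] (h60 : Nat.card X = 60) (f : ℕ → ℕ) :
    ∑ x : X, f (orderOf x) = f 1 + 15 * f 2 + 20 * f 3 + 24 * f 5 := by
  classical
  have : Fact (Nat.Prime 5) := ⟨by norm_num⟩
  have h3 := card_filter_orderOf_eq_prime (G := X) (q := 3) (n := 20) (by rw [h60]) (by norm_num)
  have h5 := card_filter_orderOf_eq_prime (G := X) (q := 5) (n := 12) (by rw [h60]) (by norm_num)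
  rw [card_sylow_three_of_card_eq_sixty h60] at h3
  rw [card_sylow_five_of_card_eq_sixty h60] at h5
  have h1 : (Finset.univ.filter fun x : X => orderOf x = 1).card = 1 := by
    simp only [orderOf_eq_one_iff]
    rw [Finset.filter_eq' Finset.univ (1 : X)]
    simp
  have hmaps : ∀ x ∈ (Finset.univ : Finset X), orderOf x ∈ ({1, 2, 3, 5} : Finset ℕ) := by
    intro x _
    simpa using orderOf_of_card_eq_sixty h60 x
  have hcard := Finset.card_eq_sum_card_fiberwise hmaps
  have hsum := Finset.sum_fiberwise_of_maps_to hmaps (fun x => f (orderOf x))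
  have hinner : ∀ d, ∑ x ∈ Finset.univ.filter (fun x : X => orderOf x = d), f (orderOf x) =
      (Finset.univ.filter fun x : X => orderOf x = d).card * f d := by
    intro d
    rw [Finset.sum_congr rfl fun x hx => by rw [(Finset.mem_filter.mp hx).2], Finset.sum_const,
      smul_eq_mul]
  rw [← hsum]
  simp only [hinner]
  rw [Finset.card_univ, ← Nat.card_eq_fintype_card, h60] at hcard
  simp only [Finset.mem_insert, Finset.mem_singleton, OfNat.one_ne_ofNat, or_self,
    not_false_eq_true, Finset.sum_insert, Finset.sum_singleton, Nat.reduceEqDiff] at hcard ⊢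
  rw [h1, h3, h5] at hcard ⊢
  have h2 : (Finset.univ.filter fun x : X => orderOf x = 2).card = 15 := by omega
  rw [h2]
  ring

/-- An element of order `q = 3` or `5` of a simple group of order `60` is conjugate to one of its
powers other than itself, by Burnside's theorem. -/
theorem exists_conj_eq_pow_of_card_eq_sixty (h60 : Nat.card X = 60) {q n : ℕ} [Fact q.Prime]
    (hqn : 60 = n * q) (hqn' : ¬ q ∣ n) {x : X} (hx : orderOf x = q) :
    ∃ (g : X) (j : ℤ), g * x * g⁻¹ = x ^ j ∧ ¬ (q : ℤ) ∣ j - 1 := by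
  have hqX : q ∣ Nat.card X := by rw [h60, hqn]; exact dvd_mul_left q n
  have hpg : IsPGroup q (zpowers x) := IsPGroup.of_card (n := 1) (by
    rw [Nat.card_zpowers, hx, pow_one])
  obtain ⟨Q, hxQ⟩ := hpg.exists_le_sylow
  have hQ : zpowers x = (Q : Subgroup X) := by
    refine Subgroup.eq_of_le_of_card_ge hxQ ?_
    rw [Nat.card_zpowers, hx]
    exact (Q.card_eq_of_card_eq_mul (h60.trans hqn) hqn').le
  have hnc := not_normalizer_le_centralizer (not_isSolvable_of_card_eq_sixty h60) hqX Q
  obtain ⟨g, hg, hgc⟩ := SetLike.not_le_iff_exists.mp hnc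
  have hmem : g * x * g⁻¹ ∈ zpowers x := by
    rw [hQ]
    exact (Subgroup.mem_normalizer_iff.mp hg x).mp (hxQ (mem_zpowers x))
  obtain ⟨j, hj⟩ := Subgroup.mem_zpowers_iff.mp hmem
  refine ⟨g, j, hj.symm, fun hdvd => hgc ?_⟩
  have hj1 : x ^ j = x := by
    have : x ^ (j - 1) = 1 := orderOf_dvd_iff_zpow_eq_one.mp (hx ▸ hdvd)
    rw [zpow_sub, zpow_one, mul_inv_eq_one] at this
    exact this
  have hcomm : g * x = x * g := by
    rw [hj1] at hj
    exact mul_inv_eq_iff_eq_mul.mp hj.symm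
  intro y hy
  change y ∈ (Q : Subgroup X) at hy
  rw [← hQ] at hy
  obtain ⟨i, rfl⟩ := Subgroup.mem_zpowers_iff.mp hy
  exact (Commute.zpow_right hcomm i).symm

end Sixty

/-! ### Nonsolvable groups with a cyclic subgroup of small index -/

theorem index_eq_index_map_mul_index_subgroupOf {G : Type*} [Group G] [Finite G]
    (C N : Subgroup G) [N.Normal] :
    C.index = (C.map (QuotientGroup.mk' N)).index * (C.subgroupOf N).index := by
  have h1 : (C.map (QuotientGroup.mk' N)).index = (C ⊔ N).index := by
    rw [Subgroup.index_map, QuotientGroup.ker_mk',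
      MonoidHom.range_eq_top_of_surjective _ (QuotientGroup.mk'_surjective N), index_top, mul_one]
  have h2 := relIndex_mul_index (inf_le_left : C ⊓ N ≤ C)
  have h3 := relIndex_mul_index (inf_le_right : C ⊓ N ≤ N)
  have h4 := relIndex_mul_index (le_sup_right : N ≤ C ⊔ N)
  rw [inf_relIndex_left] at h2
  rw [inf_relIndex_right] at h3
  rw [relIndex_sup_right] at h4
  have h5 : N.relIndex C ≠ 0 := Subgroup.index_ne_zero_of_finite
  rw [h1]
  change C.index = (C ⊔ N).index * C.relIndex N
  apply Nat.eq_of_mul_eq_mul_left (Nat.pos_of_ne_zero h5)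
  rw [h2, ← h3, ← h4]
  ring

theorem exists_normal_of_not_isSimpleGroup {G : Type*} [Group G] [Nontrivial G]
    (h : ¬ IsSimpleGroup G) : ∃ N : Subgroup G, N.Normal ∧ N ≠ ⊥ ∧ N ≠ ⊤ := by
  by_contra! hcon
  exact h ⟨fun N hN => or_iff_not_imp_left.mpr (hcon N hN)⟩

theorem nontrivial_of_not_isSolvable {G : Type*} [Group G] (h : ¬ Group.IsSolvable G) :
    Nontrivial G := by
  by_contra hn
  rw [not_nontrivial_iff_subsingleton] at hn
  exact h inferInstance

theorem isSolvable_of_isCyclic {G : Type*} [Group G] [IsCyclic G] : Group.IsSolvable G :=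
  Group.isSolvable_of_comm (IsCyclic.commGroup (α := G)).mul_comm

theorem isCyclic_subgroupOf {G : Type*} [Group G] (C N : Subgroup G) [IsCyclic C] :
    IsCyclic (C.subgroupOf N) :=
  isCyclic_of_injective (N.subtype.subgroupComap C) fun a b h => by
    have h' : ((a : N) : G) = (b : N) := congrArg (fun z : C => (z : G)) h
    exact Subtype.ext (Subtype.ext h')

theorem card_quotient_lt {G : Type*} [Group G] [Finite G] {N : Subgroup G} (h : N ≠ ⊥) :
    Nat.card (G ⧸ N) < Nat.card G := by
  have h1 := N.index_mul_card
  have h2 : 1 < Nat.card N := N.one_lt_card_iff_ne_bot.mpr h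
  have h3 : N.index ≠ 0 := Subgroup.index_ne_zero_of_finite
  change N.index < _
  nlinarith [Nat.pos_of_ne_zero h3]

theorem card_subgroup_lt {G : Type*} [Group G] [Finite G] {N : Subgroup G} (h : N ≠ ⊤) :
    Nat.card N < Nat.card G :=
  lt_of_le_of_ne N.card_le_card_group fun hc => h (N.eq_top_of_card_eq hc)

/-- The index of a cyclic subgroup is multiplicative along a normal series, and each nonabelian
composition factor contributes at least `12` to it. -/
theorem index_eq_twelve {G : Type*} [Group G] [Finite G] (hG : ¬ Group.IsSolvable G)
    (C : Subgroup G) [hC : IsCyclic C] (h16 : C.index ≤ 16) : C.index = 12 := by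
  induction hm : Nat.card G using Nat.strong_induction_on generalizing G with
  | _ m ih =>
  have := nontrivial_of_not_isSolvable hG
  by_cases hs : IsSimpleGroup G
  · obtain ⟨h1, h2⟩ := card_of_isCyclic_of_index_le hG C h16
    have := C.index_mul_card
    rw [h1, h2] at this
    omega
  · obtain ⟨N, hN, hbot, htop⟩ := exists_normal_of_not_isSimpleGroup hs
    have hmul := index_eq_index_map_mul_index_subgroupOf C N
    have h1 : 0 < (C.map (QuotientGroup.mk' N)).index :=
      Nat.pos_of_ne_zero Subgroup.index_ne_zero_of_finite
    have h2 : 0 < (C.subgroupOf N).index :=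
      Nat.pos_of_ne_zero Subgroup.index_ne_zero_of_finite
    by_cases hsol : Group.IsSolvable N
    · have hq : ¬ Group.IsSolvable (G ⧸ N) := fun h =>
        hG ((Group.isSolvable_iff_subgroup_quotient N).mpr ⟨hsol, h⟩)
      have hcyc : IsCyclic (C.map (QuotientGroup.mk' N)) :=
        isCyclic_of_surjective _ ((QuotientGroup.mk' N).subgroupMap_surjective C)
      have := ih _ (hm ▸ card_quotient_lt hbot) hq (C.map (QuotientGroup.mk' N))
        (by nlinarith) rfl
      rw [this] at hmul
      omega
    · have hcyc : IsCyclic (C.subgroupOf N) :=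
        isCyclic_subgroupOf C N
      have := ih _ (hm ▸ card_subgroup_lt htop) hsol (C.subgroupOf N) (by nlinarith) rfl
      rw [this] at hmul
      omega

/-- In a finite group all of whose proper quotients are solvable, a normal subgroup that maps onto
a nonsolvable simple group with cyclic kernel is simple. -/
theorem injective_of_forall_quotient_isSolvable {G : Type*} [Group G] [Finite G]
    (hG : ¬ Group.IsSolvable G)
    (hquot : ∀ N : Subgroup G, ∀ _ : N.Normal, N ≠ ⊥ → Group.IsSolvable (G ⧸ N))
    {T : Subgroup G} [T.Normal] {X : Type*} [Group X] [IsSimpleGroup X]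
    (hX : ¬ Group.IsSolvable X) {f : T →* X} (hf : Function.Surjective f) [IsCyclic f.ker] :
    Function.Injective f := by
  have hinv : ∀ (g : G) (t : T), f t = 1 → f (MulAut.conjNormal g t) = 1 := by
    intro g t ht
    let f' : T →* X := f.comp (MulAut.conjNormal g).toMonoidHom
    have hf' : Function.Surjective f' := hf.comp (MulAut.conjNormal g).surjective
    have hn : (f.ker.map f').Normal := (MonoidHom.normal_ker f).map f' hf'
    have hmem : f' t ∈ f.ker.map f' := ⟨t, ht, rfl⟩
    rcases hn.eq_bot_or_eq_top with h | h
    · rw [h] at hmem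
      exact mem_bot.mp hmem
    · exfalso
      have hsol : Group.IsSolvable f.ker := isSolvable_of_isCyclic
      refine hX (Group.isSolvable_of_surjective (f := f'.comp f.ker.subtype) fun x => ?_)
      obtain ⟨t, ht, hx⟩ := (h ▸ mem_top x : x ∈ f.ker.map f')
      exact ⟨⟨t, ht⟩, hx⟩
  have hR : (f.ker.map T.subtype).Normal := by
    refine ⟨?_⟩
    rintro _ ⟨t, ht, rfl⟩ g
    exact ⟨MulAut.conjNormal g t, hinv g t ht, by simp⟩
  by_contra hinj
  have hbot : f.ker.map T.subtype ≠ ⊥ := by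
    rw [Ne, (f.ker).map_eq_bot_iff_of_injective T.subtype_injective]
    exact fun h => hinj ((MonoidHom.ker_eq_bot_iff f).mp h)
  have hcyc : IsCyclic (f.ker.map T.subtype) :=
    isCyclic_of_surjective _ (T.subtype.subgroupMap_surjective f.ker)
  exact hG ((Group.isSolvable_iff_subgroup_quotient _).mpr
    ⟨isSolvable_of_isCyclic, hquot _ hR hbot⟩)

/-- A group all of whose proper quotients are solvable has no proper normal simple subgroup `T` of
order `60` that meets a cyclic subgroup `C` of index `12` in a subgroup of order `5`: a generator of
`C` induces an automorphism of `T` of order dividing `5`. -/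
theorem eq_top_of_normal_of_card_eq_sixty {G : Type*} [Group G] [Finite G]
    (hquot : ∀ N : Subgroup G, ∀ _ : N.Normal, N ≠ ⊥ → Group.IsSolvable (G ⧸ N))
    (C : Subgroup G) [hC : IsCyclic C] (h12 : C.index = 12)
    {T : Subgroup G} [T.Normal] [IsSimpleGroup T] (h60 : Nat.card T = 60)
    (hCT : Nat.card (C.subgroupOf T) = 5) : T = ⊤ := by
  have hT := not_isSolvable_of_card_eq_sixty h60
  have : Fact (Nat.Prime 5) := ⟨by norm_num⟩
  have hfaith := eq_one_of_forall_smul_sylow_eq hT (q := 5) (by rw [h60]; norm_num)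
  obtain ⟨c, hc⟩ := C.isCyclic_iff_exists_zpowers_eq_top.mp hC
  have hco : orderOf c = Nat.card C := by rw [← Nat.card_zpowers, hc]
  -- the generator `x` of `C ∩ T`
  obtain ⟨y, hy⟩ := exists_prime_orderOf_dvd_card' (G := C.subgroupOf T) 5 hCT.symm.dvd
  have hyo : orderOf ((y : T) : G) = 5 := by
    rw [Subgroup.orderOf_coe, Subgroup.orderOf_coe, hy]
  have hyC : ((y : T) : G) ∈ C := Subgroup.mem_subgroupOf.mp y.2
  have h5 : 5 ∣ orderOf c := by
    rw [hco, ← hyo, ← Subgroup.orderOf_mk _ hyC]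
    exact orderOf_dvd_natCard _
  have hxo : orderOf (c ^ (orderOf c / 5)) = 5 := orderOf_pow_orderOf_div (orderOf_pos c).ne' h5
  set w := orderOf c / 5
  have hcC : c ∈ C := hc ▸ mem_zpowers c
  have hxT : c ^ w ∈ T := by
    have : c ^ w ∈ zpowers ((y : T) : G) :=
      mem_zpowers_of_pow_orderOf_eq_one (C.pow_mem hcC w) hyC (by
        rw [hyo, ← hxo, pow_orderOf_eq_one])
    exact (zpowers_le.mpr (y : T).2) this
  set x : T := ⟨c ^ w, hxT⟩
  have hx5 : orderOf x = 5 := (Subgroup.orderOf_mk _ hxT).trans hxo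
  obtain ⟨P, hP⟩ := (IsPGroup.of_card (p := 5) (G := zpowers x) (n := 1) (by
    rw [Nat.card_zpowers, hx5, pow_one])).exists_le_sylow
  have hP' : (P : Subgroup T) = zpowers x := by
    refine (Subgroup.eq_of_le_of_card_ge hP ?_).symm
    rw [Nat.card_zpowers, hx5]
    exact (P.card_eq_of_card_eq_mul (n := 12) h60 (by norm_num)).le
  have hpow := mulAut_pow_eq_one_of_sylow hfaith hx5 hP'
    (α := (MulAut.conjNormal c : MulAut T)) (w := w) (s := 5)
    (by rw [← map_pow]; exact MulAut.conjNormal_val (h := x))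
    (fun r h0 h5 hr => by
      rw [card_sylow_five_of_card_eq_sixty h60] at hr
      obtain ⟨j, rfl⟩ := h5
      have : j = 1 := by omega
      subst this; norm_num)
  set κ : G →* MulAut T := MulAut.conjNormal
  have hκ : κ.ker = ⊥ := by
    by_contra hne
    have hsol := hquot κ.ker (MonoidHom.normal_ker κ) hne
    refine hT (Group.isSolvable_of_isSolvable_injective
      (f := (QuotientGroup.mk' κ.ker).comp T.subtype) ?_)
    rw [← MonoidHom.ker_eq_bot_iff, eq_bot_iff]
    intro t ht
    have ht' : (t : G) ∈ κ.ker := (QuotientGroup.eq_one_iff _).mp ht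
    rw [MonoidHom.mem_ker] at ht'
    rw [mem_bot]
    refine hfaith t fun Q => ?_
    rw [Sylow.smul_def, ← MulAut.conjNormal_val]
    change κ t • Q = Q
    rw [ht', one_smul]
  have hc5 : c ^ 5 = 1 := by
    rw [← mem_bot, ← hκ, MonoidHom.mem_ker, map_pow]
    exact hpow
  have hle : Nat.card C ≤ 5 := hco ▸ Nat.le_of_dvd (by norm_num) (orderOf_dvd_of_pow_eq_one hc5)
  have hcard := C.index_mul_card
  refine T.eq_top_of_le_card ?_
  rw [h60, ← hcard, h12]
  omega

/-- A nonsolvable group with a cyclic subgroup `C` of index at most `16` is an extension of a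
subgroup of `C` by a simple group of order `60`. -/
theorem exists_surjective_simple_of_index_le {G : Type u} [Group G] [Finite G]
    (hG : ¬ Group.IsSolvable G) (C : Subgroup G) [hC : IsCyclic C] (h16 : C.index ≤ 16) :
    ∃ (X : Type u) (_ : Group X) (_ : IsSimpleGroup X) (f : G →* X),
      Function.Surjective f ∧ Nat.card X = 60 ∧ f.ker ≤ C := by
  induction hm : Nat.card G using Nat.strong_induction_on generalizing G with
  | _ m ih =>
  have := nontrivial_of_not_isSolvable hG
  have h12 := index_eq_twelve hG C h16
  by_cases hquot : ∀ N : Subgroup G, ∀ _ : N.Normal, N ≠ ⊥ → Group.IsSolvable (G ⧸ N)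
  · have hsimple : IsSimpleGroup G := by
      by_contra hs
      obtain ⟨T, hT, hbot, htop⟩ := exists_normal_of_not_isSimpleGroup hs
      have hTs : ¬ Group.IsSolvable T := fun h =>
        hG ((Group.isSolvable_iff_subgroup_quotient T).mpr ⟨h, hquot T hT hbot⟩)
      have hcyc : IsCyclic (C.subgroupOf T) :=
        isCyclic_subgroupOf C T
      have hT16 : (C.subgroupOf T).index ≤ 16 := by
        have hmul := index_eq_index_map_mul_index_subgroupOf C T
        have h1 : 0 < (C.map (QuotientGroup.mk' T)).index :=
          Nat.pos_of_ne_zero Subgroup.index_ne_zero_of_finite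
        nlinarith
      obtain ⟨X, _, hXs, f, hf, h60, hker⟩ :=
        ih _ (hm ▸ card_subgroup_lt htop) hTs (C.subgroupOf T) hT16 rfl
      have hkc : IsCyclic f.ker := Subgroup.isCyclic_of_le hker
      have hinj := injective_of_forall_quotient_isSolvable hG hquot
        (not_isSolvable_of_card_eq_sixty h60) hf
      let e : T ≃* X := MulEquiv.ofBijective f ⟨hinj, hf⟩
      have hTsimple : IsSimpleGroup T := e.isSimpleGroup
      have hT60 : Nat.card T = 60 := (Nat.card_congr e.toEquiv).trans h60
      exact htop (eq_top_of_normal_of_card_eq_sixty hquot C h12 hT60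
        (card_of_isCyclic_of_index_le hTs (C.subgroupOf T) hT16).2)
    refine ⟨G, inferInstance, hsimple, MonoidHom.id G, Function.surjective_id,
      (card_of_isCyclic_of_index_le hG C h16).1, ?_⟩
    rw [MonoidHom.ker_id]
    exact bot_le
  · push Not at hquot
    obtain ⟨N, hN, hbot, hns⟩ := hquot
    have hcyc : IsCyclic (C.map (QuotientGroup.mk' N)) :=
      isCyclic_of_surjective _ ((QuotientGroup.mk' N).subgroupMap_surjective C)
    have hmul := index_eq_index_map_mul_index_subgroupOf C N
    have h1 : 0 < (C.subgroupOf N).index :=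
      Nat.pos_of_ne_zero Subgroup.index_ne_zero_of_finite
    have hN16 : (C.map (QuotientGroup.mk' N)).index ≤ 16 := by nlinarith
    have hN12 := index_eq_twelve hns _ hN16
    have hNC : N ≤ C := by
      rw [h12, hN12] at hmul
      exact Subgroup.subgroupOf_eq_top.mp (Subgroup.index_eq_one.mp (by omega))
    obtain ⟨X, _, hXs, f, hf, h60, hker⟩ := ih _ (hm ▸ card_quotient_lt hbot) hns _ hN16 rfl
    refine ⟨X, _, hXs, f.comp (QuotientGroup.mk' N),
      hf.comp (QuotientGroup.mk'_surjective N), h60, fun g hg => ?_⟩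
    obtain ⟨a, ha, hag⟩ := hker (x := QuotientGroup.mk' N g) hg
    have h2 : a⁻¹ * g ∈ N := QuotientGroup.eq.mp hag
    have := C.mul_mem ha (hNC h2)
    rwa [mul_inv_cancel_left] at this

/-! ### The sum of powers of element orders of a cyclic group -/

/-- The sum `∑_{d ∣ n} φ(d) d ^ k`, which is `ψ_k` of the cyclic group of order `n`. -/
def cyclicPsi (k n : ℕ) : ℕ :=
  ∑ d ∈ n.divisors, Nat.totient d * d ^ k

theorem psi_eq_cyclicPsi (k : ℕ) (G : Type*) [Group G] [Finite G] [IsCyclic G] :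
    psi k G = cyclicPsi k (Nat.card G) := by
  classical
  have := Fintype.ofFinite G
  rw [psi_eq_sum, cyclicPsi]
  have hmaps : ∀ x ∈ (Finset.univ : Finset G), orderOf x ∈ (Nat.card G).divisors := fun x _ =>
    Nat.mem_divisors.mpr ⟨orderOf_dvd_natCard x, Nat.card_pos.ne'⟩
  rw [← Finset.sum_fiberwise_of_maps_to hmaps]
  refine Finset.sum_congr rfl fun d hd => ?_
  rw [Finset.sum_congr rfl fun x hx => by rw [(Finset.mem_filter.mp hx).2], Finset.sum_const,
    smul_eq_mul, IsCyclic.card_orderOf_eq_totient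
      (Nat.card_eq_fintype_card (α := G) ▸ Nat.dvd_of_mem_divisors hd)]

theorem psi_Zmul (k : ℕ) {n : ℕ} (hn : n ≠ 0) : psi k (Zmul n) = cyclicPsi k n := by
  have : NeZero n := ⟨hn⟩
  rw [psi_eq_cyclicPsi]
  congr 1
  exact (Nat.card_congr Multiplicative.toAdd).trans (Nat.card_zmod n)

theorem cyclicPsi_mul_of_coprime (k : ℕ) {a b : ℕ} (h : a.Coprime b) :
    cyclicPsi k (a * b) = cyclicPsi k a * cyclicPsi k b := by
  let F : ArithmeticFunction ℕ := ⟨fun n => Nat.totient n * n ^ k, by simp⟩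
  have hF : F.IsMultiplicative := by
    rw [ArithmeticFunction.IsMultiplicative.iff_ne_zero]
    refine ⟨by simp [F], fun {m n} _ _ hmn => ?_⟩
    change Nat.totient (m * n) * (m * n) ^ k = _
    rw [Nat.totient_mul hmn, mul_pow]
    change _ = Nat.totient m * m ^ k * (Nat.totient n * n ^ k)
    ring
  have key : ∀ n, cyclicPsi k n = (F * (ArithmeticFunction.zeta : ArithmeticFunction ℕ)) n := by
    intro n
    rw [ArithmeticFunction.mul_zeta_apply]
    rfl
  rw [key, key, key]
  exact (hF.mul ArithmeticFunction.isMultiplicative_zeta).map_mul_of_coprime h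

theorem cyclicPsi_one (k : ℕ) : cyclicPsi k 1 = 1 := by
  simp [cyclicPsi]

theorem totient_mul_pow_le_cyclicPsi (k : ℕ) {n : ℕ} (hn : n ≠ 0) :
    Nat.totient n * n ^ k ≤ cyclicPsi k n :=
  Finset.single_le_sum (f := fun d => Nat.totient d * d ^ k) (fun _ _ => Nat.zero_le _)
    (Nat.mem_divisors_self n hn)

theorem cyclicPsi_pos (k : ℕ) {n : ℕ} (hn : n ≠ 0) : 0 < cyclicPsi k n :=
  lt_of_lt_of_le (Nat.mul_pos (Nat.totient_pos.mpr (Nat.pos_of_ne_zero hn))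
    (pow_pos (Nat.pos_of_ne_zero hn) k)) (totient_mul_pow_le_cyclicPsi k hn)

theorem cyclicPsi_prime_pow_succ (k a : ℕ) {q : ℕ} (hq : q.Prime) :
    cyclicPsi k (q ^ (a + 1)) =
      cyclicPsi k (q ^ a) + q ^ a * (q - 1) * (q ^ (a + 1)) ^ k := by
  unfold cyclicPsi
  rw [Nat.sum_divisors_prime_pow hq, Nat.sum_divisors_prime_pow hq, Finset.sum_range_succ,
    Nat.totient_prime_pow_succ hq]

theorem cyclicPsi_prime_pow_succ_add (k a : ℕ) {q : ℕ} (hq : q.Prime) :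
    cyclicPsi k (q ^ (a + 1)) + q ^ k = q ^ (k + 1) * cyclicPsi k (q ^ a) + 1 := by
  obtain ⟨r, rfl⟩ : ∃ r, q = r + 1 := ⟨q - 1, (Nat.succ_pred_eq_of_pos hq.pos).symm⟩
  induction a with
  | zero =>
    rw [cyclicPsi_prime_pow_succ k 0 hq, pow_zero, cyclicPsi_one, Nat.add_sub_cancel]
    ring
  | succ a ih =>
    rw [cyclicPsi_prime_pow_succ k (a + 1) hq, Nat.add_sub_cancel]
    have h := cyclicPsi_prime_pow_succ k a hq
    rw [Nat.add_sub_cancel] at h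
    have e : ((r + 1) ^ (a + 1 + 1)) ^ k = (r + 1) ^ k * ((r + 1) ^ (a + 1)) ^ k := by
      rw [pow_succ, mul_pow, mul_comm]
    rw [add_right_comm, ih, h, e]
    generalize ((r + 1) ^ (a + 1)) ^ k = z
    ring

theorem cyclicPsi_prime_pow_mul_le (k a b : ℕ) {q : ℕ} (hq : q.Prime) :
    cyclicPsi k (q ^ a) * cyclicPsi k (q ^ b) ≤ cyclicPsi k (q ^ (a + b)) := by
  induction a with
  | zero => rw [pow_zero, cyclicPsi_one, one_mul, zero_add]
  | succ a ih =>
    have h1 := cyclicPsi_prime_pow_succ_add k a hq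
    have h2 := cyclicPsi_prime_pow_succ_add k (a + b) hq
    rw [add_right_comm]
    have hb := cyclicPsi_pos k (pow_pos hq.pos b).ne'
    have hk : 1 ≤ q ^ k := Nat.one_le_pow _ _ hq.pos
    have h3 := Nat.mul_le_mul_left (q ^ (k + 1)) ih
    zify at *
    nlinarith

/-- `ψ_k` of cyclic groups is supermultiplicative in the order. -/
theorem cyclicPsi_mul_le (k : ℕ) {a : ℕ} (ha : a ≠ 0) :
    ∀ {b : ℕ}, b ≠ 0 → cyclicPsi k a * cyclicPsi k b ≤ cyclicPsi k (a * b) := by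
  induction a using Nat.recOnPosPrimePosCoprime with
  | zero => exact absurd rfl ha
  | one => intro b _; rw [cyclicPsi_one, one_mul, one_mul]
  | prime_pow q n hq hn =>
    intro b hb
    obtain ⟨j, c, hc, rfl⟩ := Nat.exists_eq_pow_mul_and_not_dvd hb q hq.ne_one
    have hcop : ∀ i, (q ^ i).Coprime c := fun i =>
      Nat.Coprime.pow_left i ((Nat.Prime.coprime_iff_not_dvd hq).mpr hc)
    rw [cyclicPsi_mul_of_coprime k (hcop j), ← mul_assoc, ← mul_assoc, ← pow_add,
      cyclicPsi_mul_of_coprime k (hcop _)]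
    exact Nat.mul_le_mul_right _ (cyclicPsi_prime_pow_mul_le k n j hq)
  | coprime a b ha1 hb1 hcop iha ihb =>
    intro c hc
    have ha0 : a ≠ 0 := by omega
    have hb0 : b ≠ 0 := by omega
    rw [cyclicPsi_mul_of_coprime k hcop, mul_assoc, mul_assoc]
    exact (Nat.mul_le_mul_left _ (ihb hb0 hc)).trans (iha ha0 (mul_ne_zero hb0 hc))

theorem cyclicPsi_four (k : ℕ) : cyclicPsi k 4 = 1 + 2 ^ k + 2 * 4 ^ k := by
  rw [cyclicPsi, show Nat.divisors 4 = {1, 2, 4} by decide +kernel]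
  simp [show Nat.totient 4 = 2 by decide]
  ring

theorem cyclicPsi_sixty (k : ℕ) :
    cyclicPsi k 60 = (1 + 2 ^ k + 2 * 4 ^ k) * (1 + 2 * 3 ^ k) * (1 + 4 * 5 ^ k) := by
  have h3 : cyclicPsi k 3 = 1 + 2 * 3 ^ k := by
    rw [cyclicPsi, show Nat.divisors 3 = {1, 3} by decide +kernel]
    simp [show Nat.totient 3 = 2 by decide]
  have h5 : cyclicPsi k 5 = 1 + 4 * 5 ^ k := by
    rw [cyclicPsi, show Nat.divisors 5 = {1, 5} by decide +kernel]
    simp [show Nat.totient 5 = 4 by decide]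
  rw [show 60 = 4 * 3 * 5 by norm_num, cyclicPsi_mul_of_coprime k (by norm_num),
    cyclicPsi_mul_of_coprime k (by norm_num), cyclicPsi_four, h3, h5]

theorem three_mul_cyclicPsi_two_pow_le {k : ℕ} (hk : 2 ≤ k) (a : ℕ) :
    3 * (cyclicPsi k (2 ^ (a + 1)) * cyclicPsi k 4) ≤ 2 * cyclicPsi k (2 ^ (a + 3)) := by
  have hK : 4 ≤ 2 ^ k := (Nat.pow_le_pow_right (n := 2) (by norm_num) hk)
  have h4 : (4 : ℕ) ^ k = 2 ^ k * 2 ^ k := by rw [← mul_pow]; norm_num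
  induction a with
  | zero =>
    have h0 := cyclicPsi_prime_pow_succ_add k 0 Nat.prime_two
    have h2 := cyclicPsi_prime_pow_succ_add k 2 Nat.prime_two
    rw [pow_zero, cyclicPsi_one] at h0
    rw [show (2 : ℕ) ^ 2 = 4 by norm_num] at h2
    rw [cyclicPsi_four, h4] at h2 ⊢
    rw [pow_succ 2 k] at h0 h2
    simp only [zero_add] at h0 ⊢
    norm_num at h0 h2 ⊢
    generalize 2 ^ k = K at *
    have : cyclicPsi k 2 = K + 1 := by omega
    rw [this]
    have h8 : cyclicPsi k 8 = 1 + K + 2 * (K * K) + 4 * (K * K * K) := by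
      have : K * 2 * (1 + K + 2 * (K * K)) = 2 * K + 2 * (K * K) + 4 * (K * K * K) := by ring
      omega
    rw [h8]
    nlinarith [Nat.mul_le_mul_right (K * K) hK, Nat.mul_le_mul_right K hK]
  | succ a ih =>
    have h1 := cyclicPsi_prime_pow_succ_add k (a + 1) Nat.prime_two
    have h3 := cyclicPsi_prime_pow_succ_add k (a + 3) Nat.prime_two
    rw [show a + 1 + 3 = a + 3 + 1 by ring]
    have hb := cyclicPsi_pos k (n := 4) (by norm_num)
    have h5 := Nat.mul_le_mul_left (2 ^ (k + 1)) ih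
    zify at *
    nlinarith

theorem three_mul_cyclicPsi_sixty_mul_le {k : ℕ} (hk : 2 ≤ k) {m : ℕ} (hm : m ≠ 0)
    (h2 : 2 ∣ m) : 3 * (cyclicPsi k m * cyclicPsi k 60) ≤ 2 * cyclicPsi k (60 * m) := by
  obtain ⟨j, c, hc, rfl⟩ := Nat.exists_eq_pow_mul_and_not_dvd hm 2 (by norm_num)
  have hc0 : c ≠ 0 := fun h => hc (h ▸ dvd_zero 2)
  obtain ⟨a, rfl⟩ : ∃ a, j = a + 1 := by
    refine ⟨j - 1, ?_⟩
    have : j ≠ 0 := by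
      rintro rfl
      exact hc (by simpa using h2)
    omega
  have hcop : ∀ i, (2 ^ i).Coprime c := fun i =>
    Nat.Coprime.pow_left i ((Nat.Prime.coprime_iff_not_dvd Nat.prime_two).mpr hc)
  have hcop' : ∀ i, (2 ^ i).Coprime (15 * c) := fun i =>
    Nat.Coprime.mul_right (Nat.Coprime.pow_left i (by norm_num)) (hcop i)
  have h60 : cyclicPsi k 60 = cyclicPsi k 4 * cyclicPsi k 15 := by
    rw [show 60 = 4 * 15 by norm_num, cyclicPsi_mul_of_coprime k (by norm_num)]
  have h60m : cyclicPsi k (60 * (2 ^ (a + 1) * c)) =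
      cyclicPsi k (2 ^ (a + 3)) * cyclicPsi k (15 * c) := by
    rw [← cyclicPsi_mul_of_coprime k (hcop' _)]
    congr 1
    ring
  rw [cyclicPsi_mul_of_coprime k (hcop _), h60, h60m]
  calc 3 * (cyclicPsi k (2 ^ (a + 1)) * cyclicPsi k c * (cyclicPsi k 4 * cyclicPsi k 15))
      = 3 * (cyclicPsi k (2 ^ (a + 1)) * cyclicPsi k 4) *
          (cyclicPsi k 15 * cyclicPsi k c) := by ring
    _ ≤ 2 * cyclicPsi k (2 ^ (a + 3)) * cyclicPsi k (15 * c) :=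
        Nat.mul_le_mul (three_mul_cyclicPsi_two_pow_le hk a)
          (cyclicPsi_mul_le k (by norm_num) hc0)
    _ = _ := by ring

/-! ### Sums over the cosets of a cyclic normal subgroup -/

section Cosets

variable {G X : Type*} [Group G] [Group X] {f : G →* X}

theorem psi_le_sum_mul (k : ℕ) [Fintype G] [Fintype X] [DecidableEq X] (w : X → ℕ) (c : ℕ)
    (h : ∀ x, ∑ g ∈ Finset.univ.filter (fun g => f g = x), orderOf g ^ k ≤ w x * c) :
    psi k G ≤ (∑ x, w x) * c := by
  rw [psi_eq_sum, ← Finset.sum_fiberwise Finset.univ (fun g => f g), Finset.sum_mul]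
  exact Finset.sum_le_sum fun x _ => h x

theorem sum_fiber_eq_sum_ker [Fintype G] [Fintype f.ker] [DecidableEq X] (a : G) (F : G → ℕ) :
    ∑ g ∈ Finset.univ.filter (fun g => f g = f a), F g = ∑ h : f.ker, F (a * h) := by
  refine (Finset.sum_bij (fun (h : f.ker) _ => a * (h : G)) ?_ ?_ ?_ ?_).symm
  · intro h _
    have hh : f h = 1 := h.2
    simp [hh]
  · intro h _ h' _ he
    exact Subtype.ext (mul_left_cancel he)
  · intro g hg
    have hg' : f g = f a := (Finset.mem_filter.mp hg).2
    refine ⟨⟨a⁻¹ * g, ?_⟩, Finset.mem_univ _, mul_inv_cancel_left a g⟩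
    rw [MonoidHom.mem_ker, map_mul, map_inv, hg', inv_mul_cancel]
  · intro h _
    rfl

/-- If the coset `a N` of the cyclic normal subgroup `N` contains an element `a` with `a ^ r = 1`,
then `o(a h)` divides `r * o(h)` for `h ∈ N`, because `⟨h⟩` is normal. -/
theorem sum_fiber_le_of_pow_eq_one [Fintype G] [DecidableEq X] [IsCyclic f.ker] (k : ℕ) {a : G}
    {r : ℕ} (hr : 0 < r) (ha : a ^ r = 1) :
    ∑ g ∈ Finset.univ.filter (fun g => f g = f a), orderOf g ^ k ≤
      r ^ k * cyclicPsi k (Nat.card f.ker) := by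
  classical
  have := Fintype.ofFinite f.ker
  rw [sum_fiber_eq_sum_ker, ← psi_eq_cyclicPsi, psi_eq_sum, Finset.mul_sum]
  refine Finset.sum_le_sum fun h _ => ?_
  rw [← mul_pow]
  refine Nat.pow_le_pow_left (Nat.le_of_dvd (Nat.mul_pos hr (orderOf_pos h)) ?_) k
  have hnormal : (zpowers (h : G)).Normal := by
    refine ⟨fun y hy g => ?_⟩
    have hy' : y ∈ f.ker := (zpowers_le.mpr h.2) hy
    refine mem_zpowers_of_pow_orderOf_eq_one (D := f.ker)
      ((MonoidHom.normal_ker f).conj_mem y hy' g) h.2 ?_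
    obtain ⟨i, rfl⟩ := Subgroup.mem_zpowers_iff.mp hy
    rw [conj_pow, ← zpow_natCast, ← zpow_mul, mul_comm, zpow_mul, zpow_natCast, pow_orderOf_eq_one,
      one_zpow, mul_one, mul_inv_cancel]
  have hmem : (a * (h : G)) ^ r ∈ zpowers (h : G) := by
    rw [← QuotientGroup.eq_one_iff, QuotientGroup.mk_pow, QuotientGroup.mk_mul,
      (QuotientGroup.eq_one_iff (h : G)).mpr (mem_zpowers _), mul_one, ← QuotientGroup.mk_pow, ha,
      QuotientGroup.mk_one]
  apply orderOf_dvd_of_pow_eq_one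
  obtain ⟨i, hi⟩ := Subgroup.mem_zpowers_iff.mp hmem
  rw [pow_mul, ← hi, ← Subgroup.orderOf_coe, ← zpow_natCast, ← zpow_mul, mul_comm, zpow_mul,
    zpow_natCast, pow_orderOf_eq_one, one_zpow]

/-- For a coset of order `2` modulo a cyclic central subgroup, squaring is at most two-to-one. -/
theorem sum_fiber_le_of_orderOf_eq_two [Fintype G] [DecidableEq X] [IsCyclic f.ker] (k : ℕ)
    (hcen : f.ker ≤ center G) {a : G} (ha : f a ^ 2 = 1) :
    ∑ g ∈ Finset.univ.filter (fun g => f g = f a), orderOf g ^ k ≤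
      2 * 2 ^ k * cyclicPsi k (Nat.card f.ker) := by
  classical
  have := Fintype.ofFinite f.ker
  rw [sum_fiber_eq_sum_ker, ← psi_eq_cyclicPsi, psi_eq_sum]
  have hsq : ∀ h : f.ker, (a * (h : G)) ^ 2 = a ^ 2 * (h : G) ^ 2 := fun h =>
    Commute.mul_pow ((Subgroup.mem_center_iff.mp (hcen h.2)) a) 2
  let σ : f.ker → f.ker := fun h => ⟨(a * (h : G)) ^ 2, by
    have hh : f h = 1 := h.2
    rw [MonoidHom.mem_ker, map_pow, map_mul, hh, mul_one, ha]⟩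
  have hσ : ∀ h : f.ker, orderOf (a * (h : G)) ≤ 2 * orderOf (σ h) := by
    intro h
    refine Nat.le_of_dvd (Nat.mul_pos two_pos (orderOf_pos _)) (orderOf_dvd_of_pow_eq_one ?_)
    rw [pow_mul, ← Subgroup.orderOf_coe]
    exact pow_orderOf_eq_one _
  have hfib : ∀ y, (Finset.univ.filter fun h => σ h = y).card ≤ 2 := by
    intro y
    by_cases hne : ∃ h₀, σ h₀ = y
    · obtain ⟨h₀, rfl⟩ := hne
      refine le_trans (Finset.card_le_card_of_injOn (fun h => h * h₀⁻¹) ?_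
        fun h _ h' _ e => mul_right_cancel e)
        (IsCyclic.card_pow_eq_one_le (α := f.ker) (n := 2) two_pos)
      intro h hh
      have hh' : σ h = σ h₀ := by simpa using hh
      have e : (a * (h : G)) ^ 2 = (a * (h₀ : G)) ^ 2 := congrArg Subtype.val hh'
      rw [hsq, hsq] at e
      have e' : h ^ 2 = h₀ ^ 2 := Subtype.ext (mul_left_cancel e)
      simp only [Finset.coe_filter, Finset.mem_univ, true_and, Set.mem_ofPred_eq]
      have := (IsCyclic.commGroup (α := f.ker)).mul_comm h h₀⁻¹
      rw [Commute.mul_pow this, e', inv_pow, mul_inv_cancel]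
    · rw [Finset.filter_false_of_mem fun h _ hh => hne ⟨h, hh⟩]
      simp
  calc ∑ h : f.ker, orderOf (a * (h : G)) ^ k
      ≤ ∑ h : f.ker, 2 ^ k * orderOf (σ h) ^ k :=
        Finset.sum_le_sum fun h _ => by
          rw [← mul_pow]; exact Nat.pow_le_pow_left (hσ h) k
    _ = 2 ^ k * ∑ y : f.ker, (Finset.univ.filter fun h => σ h = y).card * orderOf y ^ k := by
        rw [← Finset.mul_sum, ← Finset.sum_fiberwise Finset.univ σ]
        congr 1
        refine Finset.sum_congr rfl fun y _ => ?_
        rw [Finset.sum_congr rfl fun h hh => by rw [(Finset.mem_filter.mp hh).2], Finset.sum_const,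
          smul_eq_mul]
    _ ≤ 2 ^ k * ∑ y : f.ker, 2 * orderOf y ^ k :=
        Nat.mul_le_mul_left _ (Finset.sum_le_sum fun y _ => Nat.mul_le_mul_right _ (hfib y))
    _ = 2 * 2 ^ k * ∑ y : f.ker, orderOf y ^ k := by
        rw [← Finset.mul_sum]; ring

theorem exists_lift_pow_eq_one_of_coprime (hf : Function.Surjective f) {x : X}
    (hcop : (orderOf x).Coprime (Nat.card f.ker)) : ∃ a, f a = x ∧ a ^ orderOf x = 1 := by
  obtain ⟨a₀, rfl⟩ := hf x
  set r := orderOf (f a₀)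
  have hmem : a₀ ^ r ∈ f.ker := by rw [MonoidHom.mem_ker, map_pow, pow_orderOf_eq_one]
  have hpow : (a₀ ^ r) ^ Nat.card f.ker = 1 := by
    have : (⟨a₀ ^ r, hmem⟩ : f.ker) ^ Nat.card f.ker = 1 := pow_card_eq_one'
    exact congrArg Subtype.val this
  obtain ⟨t, ht1, ht2⟩ := Nat.chineseRemainder hcop 1 0
  refine ⟨a₀ ^ t, ?_, ?_⟩
  · rw [map_pow]
    conv_rhs => rw [← pow_one (f a₀)]
    exact pow_eq_pow_iff_modEq.mpr ht1
  · obtain ⟨s, rfl⟩ := (Nat.modEq_zero_iff_dvd.mp ht2)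
    calc (a₀ ^ (Nat.card f.ker * s)) ^ r = ((a₀ ^ r) ^ Nat.card f.ker) ^ s := by
          rw [← pow_mul, ← pow_mul, ← pow_mul]
          congr 1
          ring
      _ = 1 := by rw [hpow, one_pow]

/-- If `x` has prime order `q` and is conjugate to `x ^ j` with `j ≢ 1` modulo `q`, then `x` lifts
to an element of order `q` of each central extension: for a lift `a`, the relation
`a ^ q = a ^ (j q) z ^ q` shows that `a ^ q` is the `q`-th power of a central element. -/
theorem exists_lift_pow_eq_one_of_conj (hf : Function.Surjective f) (hcen : f.ker ≤ center G)
    {x : X} {q : ℕ} (hq : q.Prime) (hx : orderOf x = q) {g : X} {j : ℤ}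
    (hg : g * x * g⁻¹ = x ^ j) (hj : ¬ (q : ℤ) ∣ j - 1) : ∃ a, f a = x ∧ a ^ q = 1 := by
  obtain ⟨a, rfl⟩ := hf x
  obtain ⟨b, rfl⟩ := hf g
  have hz : (a ^ j)⁻¹ * (b * a * b⁻¹) ∈ f.ker := by
    rw [MonoidHom.mem_ker, map_mul, map_inv, map_zpow, map_mul, map_mul, map_inv, hg,
      inv_mul_cancel]
  obtain ⟨z, hz', hzb⟩ : ∃ z ∈ f.ker, b * a * b⁻¹ = a ^ j * z := ⟨_, hz, by group⟩
  have haq : a ^ q ∈ f.ker := by rw [MonoidHom.mem_ker, map_pow, ← hx, pow_orderOf_eq_one]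
  have hzc : ∀ y, Commute y z := fun y => Subgroup.mem_center_iff.mp (hcen hz') y
  have hac : ∀ y, Commute y (a ^ q) := fun y => Subgroup.mem_center_iff.mp (hcen haq) y
  have h1 : a ^ q = (a ^ q) ^ j * z ^ q := by
    have e1 : (b * a * b⁻¹) ^ q = a ^ q := by
      rw [conj_pow, (hac b).eq, mul_inv_cancel_right]
    have e2 : (a ^ j) ^ q = (a ^ q) ^ j := by
      rw [← zpow_natCast, ← zpow_mul, mul_comm, zpow_mul, zpow_natCast]
    calc a ^ q = (a ^ j * z) ^ q := by rw [← e1, hzb]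
      _ = _ := by rw [(hzc _).mul_pow, e2]
  obtain ⟨u, v, huv⟩ : IsCoprime (j - 1) (q : ℤ) :=
    ((Nat.prime_iff_prime_int.mp hq).coprime_iff_not_dvd.mpr hj).symm
  set y := a ^ q
  have h2 : y ^ (j - 1) = (z ^ q)⁻¹ := by
    rw [eq_inv_mul_of_mul_eq h1.symm, mul_inv_rev, inv_inv, sub_eq_neg_add, zpow_add, zpow_neg_one]
  have h3 : y = (z ^ (-u) * y ^ v) ^ q := by
    have e1 : (z ^ (-u)) ^ q = (y ^ (j - 1)) ^ u := by
      rw [h2, inv_zpow', ← zpow_natCast, ← zpow_natCast, ← zpow_mul, ← zpow_mul, mul_comm]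
    rw [(((hac z).zpow_zpow (-u) v)).mul_pow, e1, ← zpow_natCast, ← zpow_mul, ← zpow_mul,
      ← zpow_add, mul_comm (j - 1), huv, zpow_one]
  set t := z ^ (-u) * y ^ v
  have ht : t ∈ f.ker := f.ker.mul_mem (f.ker.zpow_mem hz' _) (f.ker.zpow_mem haq _)
  have htc : Commute a t⁻¹ := Subgroup.mem_center_iff.mp (hcen (f.ker.inv_mem ht)) a
  refine ⟨a * t⁻¹, ?_, ?_⟩
  · rw [map_mul, map_inv, MonoidHom.mem_ker.mp ht, inv_one, mul_one]
  · rw [htc.mul_pow, inv_pow, ← h3, mul_inv_cancel]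

end Cosets

/-- A cyclic normal subgroup with nonabelian simple quotient is central. -/
theorem ker_le_center_of_isSimpleGroup {G X : Type*} [Group G] [Group X] [IsSimpleGroup X]
    (hX : ¬ Group.IsSolvable X) {f : G →* X} (hf : Function.Surjective f) [IsCyclic f.ker] :
    f.ker ≤ center G := by
  set κ : G →* MulAut f.ker := MulAut.conjNormal
  have hcomm : ∀ α β : MulAut f.ker, α * β = β * α := fun α β =>
    (IsCyclic.mulAutMulEquiv f.ker).injective (by rw [map_mul, map_mul, mul_comm])
  have hker : f.ker ≤ κ.ker := by
    intro n hn
    rw [MonoidHom.mem_ker]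
    ext m
    change ((MulAut.conjNormal n m : f.ker) : G) = m
    have := congrArg Subtype.val ((IsCyclic.commGroup (α := f.ker)).mul_comm ⟨n, hn⟩ m)
    rw [MulAut.conjNormal_apply]
    exact mul_inv_eq_iff_eq_mul.mpr this
  have htop : ∀ g, g ∈ κ.ker := by
    rcases ((MonoidHom.normal_ker κ).map f hf).eq_bot_or_eq_top with h | h
    · exfalso
      refine hX (Group.isSolvable_of_comm fun x y => ?_)
      obtain ⟨a, rfl⟩ := hf x
      obtain ⟨b, rfl⟩ := hf y
      have hmem : (b * a)⁻¹ * (a * b) ∈ κ.ker := by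
        rw [MonoidHom.mem_ker, map_mul, map_inv, map_mul, map_mul,
          hcomm (κ a) (κ b), inv_mul_cancel]
      have h1 : f ((b * a)⁻¹ * (a * b)) ∈ κ.ker.map f := ⟨_, hmem, rfl⟩
      rw [h, mem_bot, map_mul, map_inv, inv_mul_eq_one, map_mul, map_mul] at h1
      exact h1.symm
    · intro g
      obtain ⟨z, hz, hzg⟩ := (h ▸ mem_top (f g) : f g ∈ κ.ker.map f)
      have : z⁻¹ * g ∈ f.ker := by
        rw [MonoidHom.mem_ker, map_mul, map_inv, hzg, inv_mul_cancel]
      have := κ.ker.mul_mem hz (hker this)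
      rwa [mul_inv_cancel_left] at this
  intro n hn
  rw [Subgroup.mem_center_iff]
  intro g
  have h1 := DFunLike.congr_fun (MonoidHom.mem_ker.mp (htop g)) ⟨n, hn⟩
  have h2 : g * n * g⁻¹ = n := by
    rw [← MulAut.conjNormal_apply g (⟨n, hn⟩ : f.ker)]
    exact congrArg Subtype.val h1
  exact mul_inv_eq_iff_eq_mul.mp h2

/-! ### Extensions of cyclic groups -/

/-- The sum `ψ_k(A₅) = 1 + 15 * 2 ^ k + 20 * 3 ^ k + 24 * 5 ^ k`. -/
def altFivePsi (k : ℕ) : ℕ :=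
  1 + 15 * 2 ^ k + 20 * 3 ^ k + 24 * 5 ^ k

theorem psi_of_card_eq_sixty {X : Type*} [Group X] [Finite X] [IsSimpleGroup X]
    (h60 : Nat.card X = 60) (k : ℕ) : psi k X = altFivePsi k := by
  have := Fintype.ofFinite X
  rw [psi_eq_sum, sum_orderOf_of_card_eq_sixty h60 fun d => d ^ k, one_pow, altFivePsi]

/-- A normal cyclic Sylow subgroup can be split off. -/
theorem psi_le_of_sylow_normal {G : Type*} [Group G] [Finite G] (k : ℕ) {p : ℕ} [Fact p.Prime]
    (P : Sylow p G) [(P : Subgroup G).Normal] [IsCyclic P] :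
    psi k G ≤ psi k (G ⧸ (P : Subgroup G)) * cyclicPsi k (Nat.card P) := by
  classical
  have := Fintype.ofFinite G
  have := Fintype.ofFinite (G ⧸ (P : Subgroup G))
  set f := QuotientGroup.mk' (P : Subgroup G)
  have hker : f.ker = P := QuotientGroup.ker_mk' _
  have hcard : Nat.card f.ker = Nat.card P := by rw [hker]
  have hcyc : IsCyclic f.ker := by rw [hker]; assumption
  rw [← hcard, psi_eq_sum k (G ⧸ (P : Subgroup G))]
  refine psi_le_sum_mul (f := f) k (fun x => orderOf x ^ k) _ fun x => ?_
  have hcop : (orderOf x).Coprime (Nat.card f.ker) := by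
    rw [hcard]
    exact (Nat.Coprime.coprime_dvd_right (orderOf_dvd_natCard x) P.card_coprime_index).symm
  obtain ⟨a, rfl, ha⟩ :=
    exists_lift_pow_eq_one_of_coprime (QuotientGroup.mk'_surjective (P : Subgroup G)) hcop
  exact sum_fiber_le_of_pow_eq_one (f := f) k (orderOf_pos _) ha

/-- The bound for an extension of a cyclic group by a simple group of order `60`. The cosets of
order `2` are the only ones that may have no representative of the same order, which costs a
factor `2` on them; this is compensated by the gap between `ψ_k(ℤ₆₀) ψ_k(ℤ_m)` and
`ψ_k(ℤ_{60 m})` for even `m`. -/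
theorem psi_mul_cyclicPsi_sixty_le {G X : Type*} [Group G] [Finite G] [Group X]
    [IsSimpleGroup X] {k : ℕ} (hk : 2 ≤ k) {f : G →* X} (hf : Function.Surjective f)
    (h60 : Nat.card X = 60) [IsCyclic f.ker] :
    psi k G * cyclicPsi k 60 ≤ altFivePsi k * cyclicPsi k (Nat.card G) := by
  classical
  have hXf : Finite X := Finite.of_surjective f hf
  have := Fintype.ofFinite G
  have := Fintype.ofFinite X
  have hcen := ker_le_center_of_isSimpleGroup (not_isSolvable_of_card_eq_sixty h60) hf
  have hGcard : Nat.card G = 60 * Nat.card f.ker := by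
    rw [← f.ker.index_mul_card, Subgroup.index_ker, MonoidHom.range_eq_top_of_surjective f hf,
      Subgroup.card_top, h60]
  have hμ : Nat.card f.ker ≠ 0 := Nat.card_pos.ne'
  -- cosets whose order is not `2` have a representative of the same order
  have hlift : ∀ x : X, orderOf x ≠ 2 → ∃ a, f a = x ∧ a ^ orderOf x = 1 := by
    intro x hx2
    rcases orderOf_of_card_eq_sixty h60 x with h | h | h | h
    · exact ⟨1, by rw [map_one, orderOf_eq_one_iff.mp h], one_pow _⟩
    · exact absurd h hx2
    · have : Fact (Nat.Prime 3) := ⟨by norm_num⟩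
      obtain ⟨g, j, hg, hj⟩ := exists_conj_eq_pow_of_card_eq_sixty h60 (q := 3) (n := 20)
        (by norm_num) (by norm_num) h
      rw [h]
      exact exists_lift_pow_eq_one_of_conj hf hcen (by norm_num) h hg hj
    · have : Fact (Nat.Prime 5) := ⟨by norm_num⟩
      obtain ⟨g, j, hg, hj⟩ := exists_conj_eq_pow_of_card_eq_sixty h60 (q := 5) (n := 12)
        (by norm_num) (by norm_num) h
      rw [h]
      exact exists_lift_pow_eq_one_of_conj hf hcen (by norm_num) h hg hj
  rw [hGcard]
  by_cases h2 : 2 ∣ Nat.card f.ker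
  · have hbound : psi k G ≤
        (1 + 15 * (2 * 2 ^ k) + 20 * 3 ^ k + 24 * 5 ^ k) * cyclicPsi k (Nat.card f.ker) := by
      have hsum := sum_orderOf_of_card_eq_sixty h60
        fun d => if d = 2 then 2 * 2 ^ k else d ^ k
      norm_num at hsum
      rw [← hsum]
      refine psi_le_sum_mul (f := f) k _ _ fun x => ?_
      split_ifs with hx
      · obtain ⟨a, rfl⟩ := hf x
        exact sum_fiber_le_of_orderOf_eq_two (f := f) k hcen (by rw [← hx, pow_orderOf_eq_one])
      · obtain ⟨a, rfl, ha⟩ := hlift x hx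
        exact sum_fiber_le_of_pow_eq_one (f := f) k (orderOf_pos _) ha
    have hF := three_mul_cyclicPsi_sixty_mul_le hk hμ h2
    have h23 : 2 ^ k ≤ 3 ^ k := Nat.pow_le_pow_left (by norm_num) k
    have hnum : 2 * (1 + 15 * (2 * 2 ^ k) + 20 * 3 ^ k + 24 * 5 ^ k) ≤ 3 * altFivePsi k := by
      unfold altFivePsi
      have : 2 * 5 ^ k ≤ 3 * 5 ^ k := by omega
      omega
    refine Nat.le_of_mul_le_mul_left (c := 6) ?_ (by norm_num)
    calc 6 * (psi k G * cyclicPsi k 60)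
        ≤ 6 * ((1 + 15 * (2 * 2 ^ k) + 20 * 3 ^ k + 24 * 5 ^ k) *
            cyclicPsi k (Nat.card f.ker) * cyclicPsi k 60) :=
          Nat.mul_le_mul_left _ (Nat.mul_le_mul_right _ hbound)
      _ = 2 * (1 + 15 * (2 * 2 ^ k) + 20 * 3 ^ k + 24 * 5 ^ k) *
            (3 * (cyclicPsi k (Nat.card f.ker) * cyclicPsi k 60)) := by ring
      _ ≤ 3 * altFivePsi k * (2 * cyclicPsi k (60 * Nat.card f.ker)) := Nat.mul_le_mul hnum hF
      _ = 6 * (altFivePsi k * cyclicPsi k (60 * Nat.card f.ker)) := by ring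
  · have hbound : psi k G ≤ altFivePsi k * cyclicPsi k (Nat.card f.ker) := by
      rw [← psi_of_card_eq_sixty h60, psi_eq_sum k X]
      refine psi_le_sum_mul (f := f) k _ _ fun x => ?_
      obtain ⟨a, rfl, ha⟩ : ∃ a, f a = x ∧ a ^ orderOf x = 1 := by
        by_cases hx : orderOf x = 2
        · refine exists_lift_pow_eq_one_of_coprime hf ?_
          rw [hx]
          exact (Nat.Prime.coprime_iff_not_dvd Nat.prime_two).mpr h2
        · exact hlift x hx
      exact sum_fiber_le_of_pow_eq_one (f := f) k (orderOf_pos _) ha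
    calc psi k G * cyclicPsi k 60
        ≤ altFivePsi k * cyclicPsi k (Nat.card f.ker) * cyclicPsi k 60 :=
          Nat.mul_le_mul_right _ hbound
      _ = altFivePsi k * (cyclicPsi k 60 * cyclicPsi k (Nat.card f.ker)) := by ring
      _ ≤ _ := Nat.mul_le_mul_left _ (cyclicPsi_mul_le k (by norm_num) hμ)

/-! ### The index of a cyclic subgroup of maximal order -/

theorem three_mul_cyclicPsi_sixty_le {k : ℕ} (hk : 4 ≤ k) :
    3 * cyclicPsi k 60 ≤ 2 * 12 ^ k * altFivePsi k := by
  have h2 : 16 ≤ 2 ^ k := Nat.pow_le_pow_right (n := 2) (by norm_num) hk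
  have h3 : 81 ≤ 3 ^ k := Nat.pow_le_pow_right (n := 3) (by norm_num) hk
  have h4 : (4 : ℕ) ^ k = 2 ^ k * 2 ^ k := by rw [← mul_pow]; norm_num
  have h12 : (12 : ℕ) ^ k = 2 ^ k * 2 ^ k * 3 ^ k := by rw [← mul_pow, ← mul_pow]; norm_num
  have h5 : (5 : ℕ) ^ k ≤ 2 ^ k * 3 ^ k := by
    rw [← mul_pow]; exact Nat.pow_le_pow_left (by norm_num) k
  rw [cyclicPsi_sixty, altFivePsi, h4, h12]
  generalize (2 : ℕ) ^ k = A at *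
  generalize (3 : ℕ) ^ k = B at *
  generalize (5 : ℕ) ^ k = E at *
  -- both sides have leading term `48 A² B E`; the terms `A³ B` and `A² B²` on the right dominate
  -- what remains on the left, since `E ≤ A B`, `16 ≤ A` and `81 ≤ B`
  have e1 := Nat.mul_le_mul_left (A * B) h5
  have e2 := Nat.mul_le_mul_left B h5
  have e3 := Nat.mul_le_mul_left (A * A) h5
  have e4 := Nat.mul_le_mul_left A h5
  have f1 := Nat.mul_le_mul_right (A * B * B) h2
  have f2 := Nat.mul_le_mul_right (A * A * B) h3
  have f3 := Nat.mul_le_mul_right (A * B) h2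
  have f4 := Nat.mul_le_mul_right (A * A) h3
  have f5 := Nat.mul_le_mul_right A h2
  have f6 := Nat.mul_le_mul_right B h2
  linarith [Nat.zero_le (A * A * A * B)]

theorem prod_one_sub_inv_Icc {p : ℕ} (hp : 16 ≤ p) :
    ∏ j ∈ Finset.Icc 17 p, (1 - (j : ℚ)⁻¹) = 16 / p := by
  induction p, hp using Nat.le_induction with
  | base => norm_num
  | succ n hn ih =>
    rw [Finset.prod_Icc_succ_top (by omega), ih]
    have : (n : ℚ) ≠ 0 := by positivity
    push_cast
    field_simp
    ring

/-- Mertens-type bound for `φ(n) / n` in terms of a bound `p` for the primes dividing `n`. -/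
theorem mul_le_mul_totient {n p : ℕ} (hp : 16 ≤ p) (hn : ∀ q ∈ n.primeFactors, q ≤ p) :
    3072 * n ≤ 1001 * p * Nat.totient n := by
  have hsub : n.primeFactors ⊆ {2, 3, 5, 7, 11, 13} ∪ Finset.Icc 17 p := by
    intro q hq
    have hqp := Nat.prime_of_mem_primeFactors hq
    have hle := hn q hq
    by_cases h : 17 ≤ q
    · exact Finset.mem_union_right _ (Finset.mem_Icc.mpr ⟨h, hle⟩)
    · refine Finset.mem_union_left _ ?_
      have : q < 17 := by omega
      revert hqp
      clear hq hle h
      interval_cases q <;> norm_num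
  have hfac : ∀ q : ℕ, 0 ≤ 1 - (q : ℚ)⁻¹ ∧ 1 - (q : ℚ)⁻¹ ≤ 1 := by
    intro q
    have h0 : 0 ≤ (q : ℚ)⁻¹ := by positivity
    exact ⟨sub_nonneg.mpr (Nat.cast_inv_le_one q), by linarith⟩
  have hprod : ∏ q ∈ {2, 3, 5, 7, 11, 13} ∪ Finset.Icc 17 p, (1 - (q : ℚ)⁻¹) ≤
      ∏ q ∈ n.primeFactors, (1 - (q : ℚ)⁻¹) := by
    rw [← Finset.prod_sdiff hsub]
    exact mul_le_of_le_one_left (Finset.prod_nonneg fun q _ => (hfac q).1)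
      (Finset.prod_le_one (fun q _ => (hfac q).1) fun q _ => (hfac q).2)
  have hdisj : Disjoint ({2, 3, 5, 7, 11, 13} : Finset ℕ) (Finset.Icc 17 p) := by
    rw [Finset.disjoint_left]
    intro a ha ha'
    have := (Finset.mem_Icc.mp ha').1
    simp only [Finset.mem_insert, Finset.mem_singleton] at ha
    omega
  rw [Finset.prod_union hdisj, prod_one_sub_inv_Icc hp] at hprod
  have h6 : ∏ q ∈ ({2, 3, 5, 7, 11, 13} : Finset ℕ), (1 - (q : ℚ)⁻¹) = 192 / 1001 := by
    norm_num [Finset.prod_insert]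
  rw [h6] at hprod
  have htot := Nat.totient_eq_mul_prod_factors n
  have hp0 : (0 : ℚ) < p := by positivity
  have key : (3072 * n : ℚ) ≤ 1001 * p * Nat.totient n := by
    rw [htot]
    have h1 := mul_le_mul_of_nonneg_left hprod (by positivity : (0 : ℚ) ≤ 1001 * p * n)
    calc (3072 * n : ℚ) = 1001 * p * n * (192 / 1001 * (16 / p)) := by field_simp; ring
      _ ≤ _ := h1
      _ = _ := by ring
  exact_mod_cast key

/-- If the asserted bound fails, the cyclic subgroups of maximal order have small index. -/
theorem exists_isCyclic_index_lt {G : Type*} [Group G] [Finite G] {k : ℕ} (hk : 4 ≤ k)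
    (h : altFivePsi k * cyclicPsi k (Nat.card G) < psi k G * cyclicPsi k 60) :
    ∃ C : Subgroup G, IsCyclic C ∧ (12 ≤ C.index →
      C.index ^ 4 * (3 * Nat.totient (Nat.card G)) < 41472 * Nat.card G) := by
  have := Fintype.ofFinite G
  obtain ⟨x, hx⟩ := Finite.exists_max (fun g : G => orderOf g)
  refine ⟨zpowers x, inferInstance, fun h12 => ?_⟩
  have hcard := (zpowers x).index_mul_card
  rw [Nat.card_zpowers] at hcard
  set d := (zpowers x).index
  set m := orderOf x
  set n := Nat.card G
  set φ := Nat.totient n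
  have hm : 0 < m := orderOf_pos x
  have hn : n ≠ 0 := Nat.card_pos.ne'
  have hpsi : psi k G ≤ n * m ^ k := by
    rw [psi_eq_sum]
    refine (Finset.sum_le_card_nsmul _ _ (m ^ k) fun g _ => Nat.pow_le_pow_left (hx g) k).trans ?_
    rw [Finset.card_univ, ← Nat.card_eq_fintype_card, smul_eq_mul]
  have hA : 0 < altFivePsi k := by unfold altFivePsi; positivity
  have h1 : altFivePsi k * m ^ k * (3 * φ * d ^ k) < altFivePsi k * m ^ k * (2 * 12 ^ k * n) := by
    calc altFivePsi k * m ^ k * (3 * φ * d ^ k) = 3 * (altFivePsi k * (φ * n ^ k)) := by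
          rw [← hcard, mul_pow]; ring
      _ ≤ 3 * (altFivePsi k * cyclicPsi k n) :=
          Nat.mul_le_mul_left _ (Nat.mul_le_mul_left _ (totient_mul_pow_le_cyclicPsi k hn))
      _ < 3 * (psi k G * cyclicPsi k 60) := Nat.mul_lt_mul_of_pos_left h (by norm_num)
      _ ≤ 3 * (n * m ^ k * cyclicPsi k 60) :=
          Nat.mul_le_mul_left _ (Nat.mul_le_mul_right _ hpsi)
      _ = n * m ^ k * (3 * cyclicPsi k 60) := by ring
      _ ≤ n * m ^ k * (2 * 12 ^ k * altFivePsi k) :=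
          Nat.mul_le_mul_left _ (three_mul_cyclicPsi_sixty_le hk)
      _ = _ := by ring
  have h2 := lt_of_mul_lt_mul_left h1 (Nat.zero_le _)
  obtain ⟨j, rfl⟩ := Nat.exists_eq_add_of_le hk
  have hj : 12 ^ j ≤ d ^ j := Nat.pow_le_pow_left h12 j
  have hd : 0 < d ^ j := pow_pos (by omega) j
  refine lt_of_mul_lt_mul_right (a := d ^ j) ?_ (Nat.zero_le _)
  calc d ^ 4 * (3 * φ) * d ^ j = 3 * φ * d ^ (4 + j) := by rw [pow_add]; ring
    _ < 2 * 12 ^ (4 + j) * n := h2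
    _ = 41472 * n * 12 ^ j := by rw [pow_add]; ring
    _ ≤ 41472 * n * d ^ j := Nat.mul_le_mul_left _ hj

/-- A finite nonsolvable group `G` of order `n` satisfies
`ψ_k(G) / ψ_k(ℤ_n) ≤ ψ_k(A₅) / ψ_k(ℤ₆₀)` for `k ≥ 4`. -/
theorem psi_mul_cyclicPsi_sixty_le_of_not_isSolvable {G : Type u} [Group G] [Finite G] {k : ℕ}
    (hk : 4 ≤ k) (hG : ¬ Group.IsSolvable G) :
    psi k G * cyclicPsi k 60 ≤ altFivePsi k * cyclicPsi k (Nat.card G) := by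
  induction hm : Nat.card G using Nat.strong_induction_on generalizing G with
  | _ m ih =>
  rw [← hm]
  by_contra! hcon
  obtain ⟨C, hC, hlt⟩ := exists_isCyclic_index_lt hk hcon
  have := nontrivial_of_not_isSolvable hG
  have hn1 : 1 < Nat.card G := Finite.one_lt_card
  have hφ : 0 < Nat.totient (Nat.card G) := Nat.totient_pos.mpr Nat.card_pos
  have hne : (Nat.card G).primeFactors.Nonempty := Nat.nonempty_primeFactors.mpr hn1
  set p := (Nat.card G).primeFactors.max' hne
  have hpmem : p ∈ (Nat.card G).primeFactors := Finset.max'_mem _ _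
  have hple : ∀ q ∈ (Nat.card G).primeFactors, q ≤ p := fun q hq => Finset.le_max' _ q hq
  have hd0 : C.index ≠ 0 := Subgroup.index_ne_zero_of_finite
  by_cases hp : p ≤ 16
  · have hmert := mul_le_mul_totient le_rfl fun q hq => (hple q hq).trans hp
    -- the bounds give `[G : C] ^ 4 < 41472 * 1001 / 576 = 72072 < 17 ^ 4`
    have h16 : C.index ≤ 16 := by
      by_contra! h17
      have h4 : 17 ^ 4 ≤ C.index ^ 4 := Nat.pow_le_pow_left h17 4
      have := hlt (by omega)
      have := Nat.mul_le_mul_right (3 * Nat.totient (Nat.card G)) h4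
      omega
    obtain ⟨X, _, hX, f, hf, h60, hker⟩ := exists_surjective_simple_of_index_le hG C h16
    have hcyc : IsCyclic f.ker := Subgroup.isCyclic_of_le hker
    exact absurd (psi_mul_cyclicPsi_sixty_le (by omega) hf h60) (not_le.mpr hcon)
  · push Not at hp
    have hpp : p.Prime := Nat.prime_of_mem_primeFactors hpmem
    have hpn : p ∣ Nat.card G := Nat.dvd_of_mem_primeFactors hpmem
    have : Fact p.Prime := ⟨hpp⟩
    have hmert := mul_le_mul_totient hp.le hple
    -- the bounds give `[G : C] ^ 4 < 41472 * 1001 / 9216 * p < 17 ^ 3 * p`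
    have hdp : C.index < p := by
      by_contra! hpd
      have h1 := hlt (by omega)
      have h3 : 17 ^ 3 ≤ p ^ 3 := Nat.pow_le_pow_left hp 3
      have h4 : p ^ 4 ≤ C.index ^ 4 := Nat.pow_le_pow_left hpd 4
      have h5 : 4913 * p ≤ p ^ 4 := by nlinarith
      have h6 := Nat.mul_le_mul_right (3 * Nat.totient (Nat.card G)) (h5.trans h4)
      generalize p * Nat.totient (Nat.card G) = t at *
      have e1 : 4913 * p * (3 * Nat.totient (Nat.card G)) =
        14739 * (p * Nat.totient (Nat.card G)) := by ring
      have e2 : 1001 * p * Nat.totient (Nat.card G) =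
        1001 * (p * Nat.totient (Nat.card G)) := by ring
      have e3 : 0 < p * Nat.totient (Nat.card G) := Nat.mul_pos hpp.pos hφ
      omega
    -- the Sylow `p`-subgroup is cyclic and normal, and is split off
    have hndvd : ¬ p ∣ C.index := fun h => by
      have := Nat.le_of_dvd (Nat.pos_of_ne_zero hd0) h
      omega
    obtain ⟨Q, hQ⟩ := exists_sylow_le_of_not_dvd_index hndvd
    have hcardQ : Nat.card (Sylow p G) ∣ C.index :=
      Q.card_eq_index_normalizer ▸
        Subgroup.index_dvd_of_le (Subgroup.le_normalizer_of_isCyclic hQ)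
    have hone : Nat.card (Sylow p G) = 1 := by
      have hmod := card_sylow_modEq_one p G
      have hlt' : Nat.card (Sylow p G) < p :=
        (Nat.le_of_dvd (Nat.pos_of_ne_zero hd0) hcardQ).trans_lt hdp
      rw [Nat.ModEq, Nat.mod_eq_of_lt hlt', Nat.mod_eq_of_lt hpp.one_lt] at hmod
      exact hmod
    have hnormal : (Q : Subgroup G).Normal := by
      rw [← Subgroup.normalizer_eq_top_iff, ← Subgroup.index_eq_one]
      exact Q.card_eq_index_normalizer.symm.trans hone
    have hcyc : IsCyclic Q := Subgroup.isCyclic_of_le hQ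
    have hquot : ¬ Group.IsSolvable (G ⧸ (Q : Subgroup G)) := fun h =>
      hG ((Group.isSolvable_iff_subgroup_quotient (Q : Subgroup G)).mpr
        ⟨isSolvable_of_isCyclic, h⟩)
    have hIH := ih _ (hm ▸ card_quotient_lt (Q.ne_bot_of_dvd_card hpn)) hquot rfl
    have hmul : cyclicPsi k (Nat.card G) =
        cyclicPsi k (Nat.card (G ⧸ (Q : Subgroup G))) * cyclicPsi k (Nat.card Q) := by
      have hidx : Nat.card (G ⧸ (Q : Subgroup G)) = (Q : Subgroup G).index := rfl
      rw [hidx, ← cyclicPsi_mul_of_coprime k Q.card_coprime_index.symm]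
      congr 1
      exact ((Q : Subgroup G).index_mul_card).symm
    refine absurd hcon (not_lt.mpr ?_)
    calc psi k G * cyclicPsi k 60
        ≤ psi k (G ⧸ (Q : Subgroup G)) * cyclicPsi k (Nat.card Q) * cyclicPsi k 60 :=
          Nat.mul_le_mul_right _ (psi_le_of_sylow_normal k Q)
      _ = psi k (G ⧸ (Q : Subgroup G)) * cyclicPsi k 60 * cyclicPsi k (Nat.card Q) := by ring
      _ ≤ altFivePsi k * cyclicPsi k (Nat.card (G ⧸ (Q : Subgroup G))) *
            cyclicPsi k (Nat.card Q) := Nat.mul_le_mul_right _ hIH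
      _ = _ := by rw [hmul, mul_assoc]

/-! ### The solvability criterion -/

theorem Dconst_eq (k : ℕ) : Dconst k = (altFivePsi k : ℝ) / (cyclicPsi k 60 : ℝ) := by
  rw [Dconst, cyclicPsi_sixty, altFivePsi]
  push_cast
  rfl

theorem isSolvable_of_Dconst_mul_lt {G : Type*} [Group G] [Finite G] {k : ℕ} (hk : 4 ≤ k)
    (h : Dconst k * (psi k (Zmul (Nat.card G)) : ℝ) < (psi k G : ℝ)) : Group.IsSolvable G := by
  by_contra hG
  have hle := psi_mul_cyclicPsi_sixty_le_of_not_isSolvable hk hG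
  have hpos : (0 : ℝ) < cyclicPsi k 60 := by exact_mod_cast cyclicPsi_pos k (by norm_num)
  rw [Dconst_eq, psi_Zmul k Nat.card_pos.ne', div_mul_eq_mul_div, div_lt_iff₀ hpos] at h
  exact absurd hle (not_le.mpr (by exact_mod_cast h))

theorem mainTheorem1 {G : Type*} [Group G] [Finite G] (n p : ℕ) (hn : Nat.card G = n)
    (hp : IsGreatest {q : ℕ | q.Prime ∧ q ∣ n} p) :
    (7 < p → (∃ k : ℕ, 4 ≤ k ∧ Dconst k * (psi k (Zmul n) : ℝ) < (psi k G : ℝ)) →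
      Group.IsSolvable G) ∧
    (p = 7 → (∃ k : ℕ, 13 ≤ k ∧ Dconst k * (psi k (Zmul n) : ℝ) < (psi k G : ℝ)) →
      Group.IsSolvable G) ∧
    (∀ k : ℕ, 1 ≤ k →
      Dconst k = (psi k (alternatingGroup (Fin 5)) : ℝ) / (psi k (Zmul 60) : ℝ)) := by
  subst hn
  refine ⟨fun _ ⟨k, hk, h⟩ => isSolvable_of_Dconst_mul_lt hk h,
    fun _ ⟨k, hk, h⟩ => isSolvable_of_Dconst_mul_lt (by omega) h, fun k _ => ?_⟩
  have : IsSimpleGroup (alternatingGroup (Fin 5)) := alternatingGroup.isSimpleGroup (by simp)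
  have h60 : Nat.card (alternatingGroup (Fin 5)) = 60 := by
    have := two_mul_nat_card_alternatingGroup (α := Fin 5)
    rw [Nat.card_perm, Nat.card_fin, show Nat.factorial 5 = 120 from rfl] at this
    omega
  rw [Dconst_eq, psi_of_card_eq_sixty h60, psi_Zmul k (by norm_num)]
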